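/- Let $\mathcal C$ be a semisimple abelian $\mathbb C$-linear category with finite-dimensional morphism spaces, carrying a rigid (left and right duals) braided monoidal structure with $\mathbb C$-bilinear tensor product, simple unit object $\mathbf 1$, braiding $R$, and a balancing $\theta$ (a natural automorphism of the identity functor with $\theta_{X\otimes Y}=R_{YX}R_{XY}(\theta_X\otimes\theta_Y)$). Let $(A,\mu,\iota_A)$ be a rigid commutative associative unital algebra in $\mathcal C$: $\dim\operatorname{Hom}_{\mathcal C}(\mathbf 1,A)=1$; the pairing $\varepsilon_A\mu\colon A\otimes A\to\mathbf 1$ is nondegenerate, where $\varepsilon_A\colon A\to\mathbf 1$ satisfies $\varepsilon_A\iota_A=\mathrm{id}$; and $\dim_{\mathcal C}A\neq0$. Assume $\theta_A=\mathrm{id}$. Let a finite group $G$ act faithfully on $A$ by algebra automorphisms $\pi_g$ with $A^G=\mathbf 1$. Let $\operatorname{Rep}A$ be the category of $A$-modules $(X,\mu_X\colon A\otimes X\to X)$ in $\mathcal C$, and let $\operatorname{Rep}^0A$ be its full subcategory of modules with $\mu_XR_{XA}R_{AX}=\mu_X$. For $A$-modules $X,Y$ let $X\otimes_AY=X\otimes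 Y/\operatorname{im}(\mu_1-\mu_2)$, where $\mu_1=\mu_X\otimes\mathrm{id}$ and $\mu_2=(\mathrm{id}\otimes\mu_Y)(R_{AX}\otimes\mathrm{id})\colon A\otimes X\otimes Y\to X\otimes Y$, with the $A$-action induced by $\mu_1$. Let $\mathcal D$ be the category whose objects are pairs $(X,\varphi_X)$, where $X\in\operatorname{Rep}A$ and $\varphi_X(g)\colon X\to X$ $(g\in G)$ are $\mathcal C$-morphisms with $\varphi_X(g)\mu_X=\mu_X(\pi_g\otimes\varphi_X(g))$, $\varphi_X(g_1)\varphi_X(g_2)=\varphi_X(g_1g_2)$ and $\varphi_X(1)=\mathrm{id}$; morphisms are the $A$-module morphisms commuting with all $\varphi(g)$. Let $\mathcal D^0\subset\mathcal D$ be the full subcategory of the objects with $X\in\operatorname{Rep}^0A$. A tensor category over $\mathbb C$ means an abelian $\mathbb C$-linear monoidal category with bilinear tensor product, finite-dimensional morphism spaces and $\operatorname{End}(\mathbf 1)=\mathbb C$. **Proposition.** 1. $\mathcal D$, with addition and scalar multiplication of morphisms as in $\mathcal C$, has a natural structure of a rigid tensor category. Its tensor product is $(X,\varphi_X)\otimes(Y,\varphi_Y)=(X\otimes_AY,\varphi_X\otimes\varphi_Y)$,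 its unit object is $(A,\pi)$, and the tensor product of morphisms, the associativity isomorphisms and the unit isomorphisms are induced by those of $\mathcal C$ along the projections $X\otimes Y\to X\otimes_AY$. The dual of $(X,\varphi_X)$ is $(X^*,\ g\mapsto\varphi_X(g^{-1})^*)$, where $X^*$ is the dual of $X$ in $\mathcal C$ (with evaluation $e_X\colon X^*\otimes X\to\mathbf 1$), and the evaluation $X^*\otimes_AX\to A$ in $\mathcal D$ composed with the projection $X^*\otimes X\to X^*\otimes_AX$ and with $\varepsilon_A$ is $e_X$. 2. $\mathcal D^0$ contains the unit object, is closed under tensor products and left and right duals in $\mathcal D$, and with the tensor structure of $\mathcal D$ it is a balanced rigid braided tensor category. Its braiding is inherited from $\mathcal C$: it is the morphism $X\otimes_AY\to Y\otimes_AX$ induced by $R_{XY}$; and the underlying $\mathcal C$-morphism of its balancing on $(X,\varphi_X)$ is $\theta_X$. If moreover $\theta_{X^*}=\theta_X^*$ for all $X\in\mathcal C$, then the same identity holds for the balancing of $\mathcal D^0$. -/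

import Mathlib

open CategoryTheory MonoidalCategory MonObj Limits

universe v u w

/-- A balancing (twist) on a braided monoidal category: a natural automorphism `θ` of the identity
functor with `θ_{X ⊗ Y} = R_{YX} R_{XY} (θ_X ⊗ θ_Y)`. -/
structure BraidedTwist (C : Type u) [Category.{v} C] [MonoidalCategory C] [BraidedCategory C] where
  θ : 𝟭 C ≅ 𝟭 C
  tensor : ∀ X Y : C, (θ.hom.app (X ⊗ Y) : X ⊗ Y ⟶ X ⊗ Y) =
    ((θ.hom.app X : X ⟶ X) ⊗ₘ (θ.hom.app Y : Y ⟶ Y)) ≫ (β_ X Y).hom ≫ (β_ Y X).hom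

namespace BraidedTwist

variable {C : Type u} [Category.{v} C] [MonoidalCategory C] [BraidedCategory C]

/-- The component `θ_X : X ⟶ X`. -/
def app (t : BraidedTwist C) (X : C) : X ⟶ X := t.θ.hom.app X

/-- Compatibility of the twist with duality: `θ_{X^*} = (θ_X)^*`. -/
def IsRibbon [RightRigidCategory C] (t : BraidedTwist C) : Prop :=
  ∀ X : C, t.app (Xᘁ) = (t.app X)ᘁ

/-- The (quantum) dimension of `X`, an endomorphism of the unit object:
`1 ⟶ X ⊗ X^* ⟶ X ⊗ X^* ⟶ X^* ⊗ X ⟶ 1`, the middle maps being `θ_X ⊗ id` and the braiding. -/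
def dim [RightRigidCategory C] (t : BraidedTwist C) (X : C) : 𝟙_ C ⟶ 𝟙_ C :=
  η_ X (Xᘁ) ≫ (t.app X ▷ (Xᘁ)) ≫ (β_ X (Xᘁ)).hom ≫ ε_ X (Xᘁ)

end BraidedTwist

attribute [local instance] Abelian.hasFiniteBiproducts in
/-- Semisimplicity: every object is a finite direct sum of simple objects. -/
def IsSemisimpleCategory (C : Type u) [Category.{v} C] [Abelian C] : Prop :=
  ∀ X : C, ∃ (n : ℕ) (S : Fin n → C), (∀ i, Simple (S i)) ∧ Nonempty (X ≅ ⨁ S)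

/-- A `ℂ`-linear monoidal category is a tensor category over `ℂ`: it is abelian, the tensor product
is bilinear, the morphism spaces are finite-dimensional, and `End(1) = ℂ`. -/
structure IsTensorCategory (D : Type u) [Category.{v} D] [inst : Preadditive D] [Linear ℂ D]
    [MonoidalCategory D] : Prop where
  abelian : ∃ ab : Abelian D, ab.toPreadditive = inst
  bilinear : ∃ _ : MonoidalPreadditive D, MonoidalLinear ℂ D
  finiteDimensional : ∀ X Y : D, FiniteDimensional ℂ (X ⟶ Y)
  unit : Module.finrank ℂ (𝟙_ D ⟶ 𝟙_ D) = 1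

section Setup

variable {C : Type u} [Category.{v} C] [MonoidalCategory C]

section Algebra

variable [Abelian C] [Linear ℂ C] [BraidedCategory C] [RightRigidCategory C]

/-- `A` (an associative unital algebra) is a rigid commutative algebra in `C`: it is commutative,
contains the unit object exactly once, the pairing `A ⊗ A ⟶ A ⟶ 1` given by
multiplication and the projection `ε` normalized by `ε ∘ ι_A = id` is nondegenerate, and
`dim A ≠ 0`. -/
structure IsRigidCommAlgebra (t : BraidedTwist C) (A : C) [MonObj A] (ε : A ⟶ 𝟙_ C) : Prop where
  comm : IsCommMonObj A
  haploid : Module.finrank ℂ (𝟙_ C ⟶ A) = 1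
  counit : η[A] ≫ ε = 𝟙 (𝟙_ C)
  nondegenerate : ∃ e : ExactPairing A A, e.evaluation' = μ[A] ≫ ε
  dim_ne_zero : t.dim A ≠ 0

end Algebra

/-- An action of the group `G` on the algebra `A` by algebra automorphisms `π_g`. -/
structure AlgAction (G : Type w) [Group G] (A : C) [MonObj A] where
  π : G →* End A
  isMonHom : ∀ g, IsMonHom (π g : A ⟶ A)

variable {G : Type w} [Group G] {A : C} [MonObj A]

/-- `A^G = 1`: the unit `ι_A : 1 ⟶ A` exhibits `1` as the object of invariants of `A`. -/
def AlgAction.InvariantsEqUnit (π : AlgAction G A) : Prop :=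
  ∀ (Z : C) (f : Z ⟶ A), (∀ g, f ≫ (π.π g : A ⟶ A) = f) → ∃! k : Z ⟶ 𝟙_ C, k ≫ η[A] = f

/-- The action `A ⊗ X ⟶ X` of `A` on an `A`-module `X`. Here `Mod C A` is the category `Rep A`. -/
abbrev CategoryTheory.Mod.act (X : Mod C A) : A ⊗ X.X ⟶ X.X := X.mod.smul

section RelativeTensor

variable [BraidedCategory C]

/-- The object property defining `Rep⁰ A ⊆ Rep A`: `μ_X ∘ R_{XA} ∘ R_{AX} = μ_X`. -/
def CategoryTheory.Mod.IsLocal (X : Mod C A) : Prop :=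
  (β_ A X.X).hom ≫ (β_ X.X A).hom ≫ X.act = X.act

/-- `μ₁ : A ⊗ (X ⊗ Y) ⟶ X ⊗ Y`, the action of `A` on the first factor. -/
def relAct₁ (X Y : Mod C A) : A ⊗ (X.X ⊗ Y.X) ⟶ X.X ⊗ Y.X :=
  (α_ A X.X Y.X).inv ≫ (X.act ▷ Y.X)

/-- `μ₂ : A ⊗ (X ⊗ Y) ⟶ X ⊗ Y`, the action of `A` on the second factor, after moving `A` past
the first one by the braiding. -/
def relAct₂ (X Y : Mod C A) : A ⊗ (X.X ⊗ Y.X) ⟶ X.X ⊗ Y.X :=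
  (α_ A X.X Y.X).inv ≫ ((β_ A X.X).hom ▷ Y.X) ≫ (α_ X.X A Y.X).hom ≫ (X.X ◁ Y.act)

/-- `p : X ⊗ Y ⟶ Z` exhibits the `A`-module `Z` as `X ⊗_A Y`, i.e. as the quotient
`X ⊗ Y / im (μ₁ - μ₂)` with the `A`-module structure induced by `μ₁`. -/
structure IsRelTensor (X Y Z : Mod C A) (p : X.X ⊗ Y.X ⟶ Z.X) : Prop where
  balanced : relAct₁ X Y ≫ p = relAct₂ X Y ≫ p
  isColimit : Nonempty (IsColimit (Cofork.ofπ p balanced))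
  act : (A ◁ p) ≫ Z.act = relAct₁ X Y ≫ p

end RelativeTensor

/-- An object `(X, φ_X)` of the category `𝒟`: an `A`-module `X` with an action `φ_X` of `G` by
`C`-endomorphisms of `X` such that `φ_X(g) ∘ μ_X = μ_X ∘ (π_g ⊗ φ_X(g))`. (In `End`, the product
`a * b` is `a ∘ b`.) -/
structure EquivMod (π : AlgAction G A) where
  M : Mod C A
  φ : G →* End M.X
  compat : ∀ g, M.act ≫ (φ g : M.X ⟶ M.X) = ((π.π g : A ⟶ A) ⊗ₘ (φ g : M.X ⟶ M.X)) ≫ M.act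

namespace EquivMod

variable {π : AlgAction G A}

/-- The underlying object of `C`. -/
abbrev X (V : EquivMod π) : C := V.M.X

/-- The `C`-morphism `φ_X(g) : X ⟶ X`. -/
abbrev ρ (V : EquivMod π) (g : G) : V.X ⟶ V.X := V.φ g

/-- A morphism of `𝒟`: a morphism of `A`-modules which commutes with all `φ(g)`. -/
@[ext]
structure Hom (V W : EquivMod π) where
  hom : V.M ⟶ W.M
  comm : ∀ g, V.ρ g ≫ hom.hom = hom.hom ≫ W.ρ g

/-- The category `𝒟`. -/
instance : Category (EquivMod π) where
  Hom V W := Hom V W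
  id V := ⟨𝟙 V.M, fun g => by simp⟩
  comp f g := ⟨f.hom ≫ g.hom, fun x => by
    rw [Mod.comp_hom', ← Category.assoc, f.comm, Category.assoc, g.comm, Category.assoc]⟩

/-- The `C`-morphism underlying a morphism of `𝒟`. -/
def toC {V W : EquivMod π} (f : V ⟶ W) : V.X ⟶ W.X := f.hom.hom

@[ext]
theorem hom_ext' {V W : EquivMod π} {f g : V ⟶ W} (h : toC f = toC g) : f = g :=
  Hom.ext (Mod.hom_ext _ _ h)

@[simp]
theorem toC_id (V : EquivMod π) : toC (𝟙 V) = 𝟙 V.X := rfl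

@[simp]
theorem toC_comp {U V W : EquivMod π} (f : U ⟶ V) (g : V ⟶ W) :
    toC (f ≫ g) = toC f ≫ toC g := rfl

/-- The object `A = (A, π)` of `𝒟`. -/
def algObj (π : AlgAction G A) : EquivMod π where
  M := { X := A, mod := ModObj.regular A }
  φ := π.π
  compat g := (π.isMonHom g).mul_hom

section Linear

variable [Preadditive C] [Linear ℂ C] [MonoidalPreadditive C] [MonoidalLinear ℂ C]

/-- The morphisms `V ⟶ W` of `𝒟` as a subspace of the space of `C`-morphisms. -/
def homSubmodule (V W : EquivMod π) : Submodule ℂ (V.X ⟶ W.X) where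
  carrier := {f | V.M.act ≫ f = (A ◁ f) ≫ W.M.act ∧ ∀ g, V.ρ g ≫ f = f ≫ W.ρ g}
  zero_mem' := by simp
  add_mem' := by
    rintro a b ⟨h1, h2⟩ ⟨h3, h4⟩
    refine ⟨?_, fun g => ?_⟩
    · rw [Preadditive.comp_add, h1, h3, MonoidalPreadditive.whiskerLeft_add,
        Preadditive.add_comp]
    · rw [Preadditive.comp_add, h2, h4, Preadditive.add_comp]
  smul_mem' := by
    rintro c a ⟨h1, h2⟩
    refine ⟨?_, fun g => ?_⟩
    · rw [Linear.comp_smul, h1, MonoidalLinear.whiskerLeft_smul, Linear.smul_comp]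
    · rw [Linear.comp_smul, h2, Linear.smul_comp]

/-- Morphisms of `𝒟` are the elements of `homSubmodule`. -/
def homEquiv (V W : EquivMod π) : (V ⟶ W) ≃ homSubmodule V W where
  toFun f := ⟨toC f, f.hom.isModHom.smul_hom, f.comm⟩
  invFun f := ⟨Mod.Hom.mk' f.1 f.2.1, f.2.2⟩
  left_inv _ := rfl
  right_inv _ := rfl

/-- `𝒟` is preadditive, with addition of morphisms as in `C`. -/
instance : Preadditive (EquivMod π) where
  homGroup V W := (homEquiv V W).addCommGroup
  add_comp _ _ _ f g h := hom_ext' (Preadditive.add_comp _ _ _ (toC f) (toC g) (toC h))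
  comp_add _ _ _ f g h := hom_ext' (Preadditive.comp_add _ _ _ (toC f) (toC g) (toC h))

/-- `𝒟` is `ℂ`-linear, with scalar multiplication of morphisms as in `C`. -/
instance : Linear ℂ (EquivMod π) where
  homModule V W := (homEquiv V W).module ℂ
  smul_comp _ _ _ r f g := hom_ext' (Linear.smul_comp _ _ _ r (toC f) (toC g))
  comp_smul _ _ _ f r g := hom_ext' (Linear.comp_smul _ _ _ (toC f) r (toC g))

end Linear

variable [BraidedCategory C]

/-- `𝒟⁰` is the full subcategory of the `(X, φ_X)` with `X` in `Rep⁰ A`. -/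
def isLocal (π : AlgAction G A) : ObjectProperty (EquivMod π) := fun V => V.M.IsLocal

/-- A monoidal structure on `𝒟`, with projections `p : X ⊗ Y ⟶ X ⊗_A Y` and an identification `e`
of its unit object with `(A, π)`, is the natural one: the tensor product is
`(X ⊗_A Y, φ_X ⊗ φ_Y)`, and the tensor product of morphisms, the associator and the unitors are
induced by those of `C`. -/
structure IsNaturalTensor [MonoidalCategory (EquivMod π)]
    (p : ∀ V W : EquivMod π, V.X ⊗ W.X ⟶ (V ⊗ W).X) (e : 𝟙_ (EquivMod π) ≅ algObj π) : Prop where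
  tensor : ∀ V W, IsRelTensor V.M W.M (V ⊗ W).M (p V W)
  action : ∀ V W g, p V W ≫ (V ⊗ W).ρ g = (V.ρ g ⊗ₘ W.ρ g) ≫ p V W
  hom : ∀ {V V' W W' : EquivMod π} (f : V ⟶ V') (g : W ⟶ W'),
    p V W ≫ toC (f ⊗ₘ g) = (toC f ⊗ₘ toC g) ≫ p V' W'
  associator : ∀ U V W, (p U V ▷ W.X) ≫ p (U ⊗ V) W ≫ toC (α_ U V W).hom =
    (α_ U.X V.X W.X).hom ≫ (U.X ◁ p V W) ≫ p U (V ⊗ W)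
  leftUnitor : ∀ V, ((η[A] ≫ toC e.inv) ▷ V.X) ≫ p (𝟙_ _) V ≫ toC (λ_ V).hom = (λ_ V.X).hom
  rightUnitor : ∀ V, (V.X ◁ (η[A] ≫ toC e.inv)) ≫ p V (𝟙_ _) ≫ toC (ρ_ V).hom = (ρ_ V.X).hom

/-- `d` identifies `W` with `(X^*, φ_X(g⁻¹)^*)` for `V = (X, φ_X)`, where `X^*` is the dual of `X`
in `C` and `ev : W ⊗ V ⟶ 1` is a pairing in `𝒟` corresponding to the evaluation
`X^* ⊗ X ⟶ 1` of `C` under `ε : A ⟶ 1`; the latter condition also determines the action of `A`. -/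
structure IsNaturalDual [RightRigidCategory C] [MonoidalCategory (EquivMod π)]
    (p : ∀ V W : EquivMod π, V.X ⊗ W.X ⟶ (V ⊗ W).X) (e : 𝟙_ (EquivMod π) ≅ algObj π)
    (ε : A ⟶ 𝟙_ C) (V W : EquivMod π) (ev : W ⊗ V ⟶ 𝟙_ (EquivMod π))
    (d : W.X ≅ (V.X)ᘁ) : Prop where
  action : ∀ g, W.ρ g ≫ d.hom = d.hom ≫ (V.ρ g⁻¹)ᘁ
  evaluation : p W V ≫ toC ev ≫ toC e.hom ≫ ε = (d.hom ▷ V.X) ≫ ε_ V.X (V.X)ᘁ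

end EquivMod

end Setup

/-! The structure of `𝒟` is built in `C` and descended along projections. Since `A` is commutative,
the inverse braiding turns a left module into a bimodule, and `X ⊗_A Y` is the coequalizer of the
right action on `X` and the left action on `Y`. Rigidity of `C` makes tensoring with a fixed object,
on either side, a left adjoint, so it preserves these coequalizers. Actions, associators and unitors
are therefore induced from `C`, and identities between them are checked after precomposition with
the epimorphisms `X ⊗ Y ⟶ X ⊗_A Y`. The maps `φ_X(g) ⊗ φ_Y(g)` descend because both factors are
semilinear along the same `π_g`. Kernels, cokernels and biproducts of `C` inherit the actions of `A`
and `G`, so `𝒟` is abelian. An `A`-linear endomorphism of `A` is determined by its value on the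
unit, so `dim Hom(1, A) = 1` forces `End(1) = ℂ` in `𝒟`.

Duality rests on the Frobenius form. Nondegeneracy of `ε ∘ μ` makes composition with `ε` a bijection
from `A`-linear maps `Z ⟶ A` to `C`-morphisms `Z ⟶ 1` (`act_linExt`, `linExt_comp`, `eq_linExt`).
The dual of `X` in `C` carries the action making the evaluation balanced, so the evaluation extends
to a linear map into `A`; the coevaluation, projected to `X ⊗_A X^*`, extends linearly from `1` to
`A`. The triangle identities then hold up to the action of `1 ⟶ A ⊗ A ⟶ A`, coevaluation followed by
multiplication (`coevaluation_curryLeft`, `coevaluation_curryRight`). That composite is `c` times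
the unit of `A`, and `θ_A = id` with commutativity gives `dim A = c`; hence `c ≠ 0`, and the
coevaluation is divided by `c`. Equivariance requires `ε ∘ π_g = ε`, which holds because `Hom(A, 1)`
is spanned by `ε` and `π_g` fixes the unit.

For local modules, a pairing `A ⊗ Z ⟶ Z ⟶ 1` factors through the multiplication of `A` and so
ignores the double braiding (`monodromy_act`). Applied to an evaluation, this shows that the double
braidings of `A` with `X` and with `X^*` cancel, so locality passes to duals. Locality is also what
lets the braiding descend to `⊗_A` (`braidMor`), and, with `θ_A = id` and the balancing axiom, what
makes `θ_X` linear over `A` (`act_twist`). -/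

namespace CategoryTheory.Mod

/-! ### Modules over a commutative algebra as bimodules. -/

variable {C : Type u} [Category.{v} C] [MonoidalCategory C] {A : C} [MonObj A]

theorem one_act (V : Mod C A) : η[A] ▷ V.X ≫ V.act = (λ_ V.X).hom :=
  ModObj.one_smul (M := A) V.X

theorem one_act_assoc (V : Mod C A)
    {Z₀ : C} (k : _ ⟶ Z₀) :
    η[A] ▷ V.X ≫ V.act ≫ k =
      (λ_ V.X).hom ≫ k :=
  (reassoc_of% (one_act V)) k

theorem mul_act (V : Mod C A) :
    μ[A] ▷ V.X ≫ V.act = (α_ A A V.X).hom ≫ A ◁ V.act ≫ V.act :=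
  ModObj.mul_smul (M := A) V.X

theorem mul_act_assoc (V : Mod C A)
    {Z₀ : C} (k : _ ⟶ Z₀) :
    μ[A] ▷ V.X ≫ V.act ≫ k =
      (α_ A A V.X).hom ≫ A ◁ V.act ≫ V.act ≫ k :=
  (reassoc_of% (mul_act V)) k

theorem act_act (V : Mod C A) :
    A ◁ V.act ≫ V.act = (α_ A A V.X).inv ≫ μ[A] ▷ V.X ≫ V.act := by
  rw [mul_act, Iso.inv_hom_id_assoc]

theorem act_act_assoc (V : Mod C A)
    {Z₀ : C} (k : _ ⟶ Z₀) :
    A ◁ V.act ≫ V.act ≫ k =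
      (α_ A A V.X).inv ≫ μ[A] ▷ V.X ≫ V.act ≫ k :=
  (reassoc_of% (act_act V)) k

variable (A) in
/-- The algebra as a module over itself. -/
abbrev unit : Mod C A := { X := A, mod := ModObj.regular A }

theorem unit_act : (unit A).act = μ[A] := rfl

variable [BraidedCategory C]

/-- The right action of `A` on a left module, obtained from the inverse braiding. -/
def ract (V : Mod C A) : V.X ⊗ A ⟶ V.X := (β_ A V.X).inv ≫ V.act

@[simp]
theorem braiding_ract (V : Mod C A) : (β_ A V.X).hom ≫ V.ract = V.act := by
  simp [ract]

theorem one_ract (V : Mod C A) : V.X ◁ η[A] ≫ V.ract = (ρ_ V.X).hom := by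
  rw [ract, BraidedCategory.braiding_inv_naturality_right_assoc, one_act]
  simp

variable [IsCommMonObj A]

/-- After braiding the right-hand `A` to the front, the two sides multiply the two copies of `A` in
opposite orders before acting; commutativity identifies them. This compatibility is what lets the
left action descend to `⊗_A`. -/
theorem act_ract (V : Mod C A) :
    V.act ▷ A ≫ V.ract = (α_ A V.X A).hom ≫ A ◁ V.ract ≫ V.act := by
  rw [← cancel_epi (β_ A (A ⊗ V.X)).hom, ← BraidedCategory.braiding_naturality_right_assoc,
    braiding_ract, BraidedCategory.braiding_tensor_right_hom]
  simp only [Category.assoc, Iso.inv_hom_id_assoc]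
  rw [← whiskerLeft_comp_assoc, braiding_ract, act_act, Iso.hom_inv_id_assoc,
    ← comp_whiskerRight_assoc, IsCommMonObj.mul_comm]

theorem mul_ract (V : Mod C A) :
    V.X ◁ μ[A] ≫ V.ract = (α_ V.X A A).inv ≫ V.ract ▷ A ≫ V.ract := by
  rw [← cancel_epi (β_ (A ⊗ A) V.X).hom, ← BraidedCategory.braiding_naturality_left_assoc,
    braiding_ract, BraidedCategory.braiding_tensor_left_hom]
  simp only [Category.assoc, Iso.hom_inv_id_assoc]
  rw [← comp_whiskerRight_assoc, braiding_ract, act_ract, Iso.inv_hom_id_assoc,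
    ← whiskerLeft_comp_assoc, braiding_ract, mul_act]

theorem unit_ract : (unit A).ract = μ[A] := by
  rw [← cancel_epi (β_ A A).hom]
  exact (braiding_ract (unit A)).trans (IsCommMonObj.mul_comm A).symm

end CategoryTheory.Mod

/-! ### Semilinear and balanced morphisms. -/

section Semilinear

variable {C : Type u} [Category.{v} C] [MonoidalCategory C] {A : C} [MonObj A]

/-- `f` is linear along the endomorphism `a` of `A`. -/
def IsSemilinear (a : A ⟶ A) {V W : Mod C A} (f : V.X ⟶ W.X) : Prop :=
  V.act ≫ f = (a ⊗ₘ f) ≫ W.act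

theorem isSemilinear_id_iff {V W : Mod C A} {f : V.X ⟶ W.X} :
    IsSemilinear (𝟙 A) f ↔ V.act ≫ f = A ◁ f ≫ W.act := by
  rw [IsSemilinear, id_tensorHom]

theorem isSemilinear_hom {V W : Mod C A} (f : V ⟶ W) : IsSemilinear (𝟙 A) f.hom :=
  isSemilinear_id_iff.2 f.isModHom.smul_hom

end Semilinear

section Balanced

variable {C : Type u} [Category.{v} C] [MonoidalCategory C] [BraidedCategory C] {A : C} [MonObj A]

/-- A morphism out of `V ⊗ W` is balanced if it equalizes the right action on `V` and the left
action on `W`. -/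
def IsBalanced (V W : Mod C A) {Z : C} (f : V.X ⊗ W.X ⟶ Z) : Prop :=
  V.ract ▷ W.X ≫ f = (α_ V.X A W.X).hom ≫ V.X ◁ W.act ≫ f

/-- The two conditions differ by precomposition with the invertible braiding of `A` past `V`, which
turns `ract` back into `act`. -/
theorem isBalanced_iff {V W : Mod C A} {Z : C} {f : V.X ⊗ W.X ⟶ Z} :
    IsBalanced V W f ↔ relAct₁ V W ≫ f = relAct₂ V W ≫ f := by
  rw [IsBalanced, relAct₁, relAct₂, ← cancel_epi ((α_ A V.X W.X).inv ≫ (β_ A V.X).hom ▷ W.X)]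
  simp only [Category.assoc, ← comp_whiskerRight_assoc, Mod.braiding_ract]

theorem IsSemilinear.ract {a : A ⟶ A} {V W : Mod C A} {f : V.X ⟶ W.X} (hf : IsSemilinear a f) :
    V.ract ≫ f = (f ⊗ₘ a) ≫ W.ract := by
  unfold IsSemilinear at hf
  rw [Mod.ract, Mod.ract, Category.assoc, hf, BraidedCategory.braiding_inv_naturality_assoc]

/-- Both factors must be semilinear along the same `a`, so that the `A` in the middle is transformed
alike whichever side it acts on. The case `a = 𝟙 A` serves module maps, `a = π_g` the group action.
-/
theorem isBalanced_tensorHom {a : A ⟶ A} {V V' W W' : Mod C A} {f : V.X ⟶ V'.X} {g : W.X ⟶ W'.X}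
    (hf : IsSemilinear a f) (hg : IsSemilinear a g) {Z : C} {p : V'.X ⊗ W'.X ⟶ Z}
    (hp : IsBalanced V' W' p) : IsBalanced V W ((f ⊗ₘ g) ≫ p) := by
  unfold IsBalanced at *
  have h1 : V.ract ▷ W.X ≫ (f ⊗ₘ g) = ((f ⊗ₘ a) ⊗ₘ g) ≫ V'.ract ▷ W'.X := by
    rw [whiskerRight_comp_tensorHom, hf.ract, tensorHom_comp_whiskerRight]
  have h2 : V.X ◁ W.act ≫ (f ⊗ₘ g) = (f ⊗ₘ (a ⊗ₘ g)) ≫ V'.X ◁ W'.act := by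
    unfold IsSemilinear at hg
    rw [whiskerLeft_comp_tensorHom, hg, tensorHom_comp_whiskerLeft]
  rw [reassoc_of% h1, reassoc_of% h2, hp, associator_naturality_assoc]

end Balanced

/-! ### Right exactness of the tensor product. -/

section Whisker

variable {C : Type u} [Category.{v} C] [MonoidalCategory C]

/-- Tensoring on the left with `Z` is left adjoint to tensoring with its left dual; right duals
serve on the other side. Hence whiskering preserves epimorphisms and coequalizers. -/
instance [LeftRigidCategory C] (Z : C) : (tensorLeft Z).IsLeftAdjoint :=
  (tensorLeftAdjunction (ᘁZ) Z).isLeftAdjoint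

instance [RightRigidCategory C] (Z : C) : (tensorRight Z).IsLeftAdjoint :=
  (tensorRightAdjunction Z (Zᘁ)).isLeftAdjoint

instance epi_whiskerLeft [LeftRigidCategory C] (Z : C) {X Y : C} (f : X ⟶ Y) [Epi f] :
    Epi (Z ◁ f) :=
  inferInstanceAs (Epi ((tensorLeft Z).map f))

instance epi_whiskerRight [RightRigidCategory C] {X Y : C} (f : X ⟶ Y) [Epi f] (Z : C) :
    Epi (f ▷ Z) :=
  inferInstanceAs (Epi ((tensorRight Z).map f))

theorem exists_whiskerLeft_desc [LeftRigidCategory C] {X Y Q : C} {f g : X ⟶ Y} {q : Y ⟶ Q}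
    {w : f ≫ q = g ≫ q} (hq : IsColimit (Cofork.ofπ q w)) (Z : C) {T : C} (k : Z ⊗ Y ⟶ T)
    (hk : Z ◁ f ≫ k = Z ◁ g ≫ k) : ∃ h : Z ⊗ Q ⟶ T, Z ◁ q ≫ h = k :=
  ⟨_, (Cofork.IsColimit.desc' (isColimitCoforkMapOfIsColimit (tensorLeft Z) w hq) k hk).2⟩

theorem exists_whiskerRight_desc [RightRigidCategory C] {X Y Q : C} {f g : X ⟶ Y} {q : Y ⟶ Q}
    {w : f ≫ q = g ≫ q} (hq : IsColimit (Cofork.ofπ q w)) (Z : C) {T : C} (k : Y ⊗ Z ⟶ T)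
    (hk : f ▷ Z ≫ k = g ▷ Z ≫ k) : ∃ h : Q ⊗ Z ⟶ T, q ▷ Z ≫ h = k :=
  ⟨_, (Cofork.IsColimit.desc' (isColimitCoforkMapOfIsColimit (tensorRight Z) w hq) k hk).2⟩

end Whisker

/-! ### The tensor product over `A`. -/

section RelTensor

variable {C : Type u} [Category.{v} C] [MonoidalCategory C] [BraidedCategory C] {A : C} [MonObj A]
  [HasCoequalizers C] (V W : Mod C A)

/-- The object `V ⊗_A W` of `C`. -/
noncomputable def relTensorObj : C :=
  coequalizer (V.ract ▷ W.X) ((α_ V.X A W.X).hom ≫ V.X ◁ W.act)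

/-- The projection `V ⊗ W ⟶ V ⊗_A W` in `C`. -/
noncomputable def relTensorObjπ : V.X ⊗ W.X ⟶ relTensorObj V W := coequalizer.π _ _

instance : Epi (relTensorObjπ V W) := inferInstanceAs (Epi (coequalizer.π _ _))

theorem relTensorObjπ_condition : V.ract ▷ W.X ≫ relTensorObjπ V W =
    ((α_ V.X A W.X).hom ≫ V.X ◁ W.act) ≫ relTensorObjπ V W :=
  coequalizer.condition _ _

theorem ract_relTensorObjπ : V.ract ▷ W.X ≫ relTensorObjπ V W =
    (α_ V.X A W.X).hom ≫ V.X ◁ W.act ≫ relTensorObjπ V W := by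
  rw [relTensorObjπ_condition, Category.assoc]

noncomputable def relTensorObjIsColimit :
    IsColimit (Cofork.ofπ (relTensorObjπ V W) (relTensorObjπ_condition V W)) :=
  coequalizerIsCoequalizer _ _

variable [RigidCategory C] [IsCommMonObj A]

/-- Since `A ⊗ -` preserves the defining coequalizer, it suffices that the action on `V` respects
the relation, which follows from `act_ract` and the interchange law. -/
theorem exists_relTensor_act : ∃ m : A ⊗ relTensorObj V W ⟶ relTensorObj V W,
    A ◁ relTensorObjπ V W ≫ m = (α_ A V.X W.X).inv ≫ V.act ▷ W.X ≫ relTensorObjπ V W := by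
  refine exists_whiskerLeft_desc (relTensorObjIsColimit V W) A _ ?_
  calc _ = 𝟙 _ ⊗≫ (A ◁ V.ract ≫ V.act) ▷ W.X ≫ relTensorObjπ V W := by monoidal
    _ = 𝟙 _ ⊗≫ (V.act ▷ A ≫ V.ract) ▷ W.X ≫ relTensorObjπ V W := by rw [Mod.act_ract]; monoidal
    _ = 𝟙 _ ⊗≫ V.act ▷ A ▷ W.X ≫ V.ract ▷ W.X ≫ relTensorObjπ V W := by monoidal
    _ = 𝟙 _ ⊗≫ (V.act ▷ (A ⊗ W.X) ≫ V.X ◁ W.act) ≫ relTensorObjπ V W := by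
        rw [ract_relTensorObjπ]; monoidal
    _ = _ := by rw [← whisker_exchange]; monoidal

/-- The `A`-module `V ⊗_A W`. -/
noncomputable def relTensor : Mod C A where
  X := relTensorObj V W
  mod :=
    { smul := (exists_relTensor_act V W).choose
      one_smul := by
        have h := (exists_relTensor_act V W).choose_spec
        set m := (exists_relTensor_act V W).choose
        change η[A] ▷ _ ≫ m = (λ_ _).hom
        rw [← cancel_epi (𝟙_ C ◁ relTensorObjπ V W), whisker_exchange_assoc, h]
        calc _ = 𝟙 _ ⊗≫ (η[A] ▷ V.X ≫ V.act) ▷ W.X ≫ relTensorObjπ V W := by monoidal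
          _ = _ := by rw [Mod.one_act]; monoidal
      mul_smul := by
        have h := (exists_relTensor_act V W).choose_spec
        set m := (exists_relTensor_act V W).choose
        change μ[A] ▷ _ ≫ m = (α_ _ _ _).hom ≫ A ◁ m ≫ m
        rw [← cancel_epi ((A ⊗ A) ◁ relTensorObjπ V W), whisker_exchange_assoc, h]
        calc _ = 𝟙 _ ⊗≫ (μ[A] ▷ V.X ≫ V.act) ▷ W.X ≫ relTensorObjπ V W := by monoidal
          _ = 𝟙 _ ⊗≫ A ◁ V.act ▷ W.X ≫
              ((α_ A V.X W.X).inv ≫ V.act ▷ W.X ≫ relTensorObjπ V W) := by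
            rw [Mod.mul_act]; monoidal
          _ = 𝟙 _ ⊗≫ A ◁ V.act ▷ W.X ≫ A ◁ relTensorObjπ V W ≫ m := by rw [← h]
          _ = 𝟙 _ ⊗≫ A ◁ ((α_ A V.X W.X).inv ≫ V.act ▷ W.X ≫ relTensorObjπ V W) ≫ m := by
            monoidal
          _ = _ := by rw [← h]; monoidal }

/-- The projection `V ⊗ W ⟶ V ⊗_A W`. -/
noncomputable def relProj : V.X ⊗ W.X ⟶ (relTensor V W).X := relTensorObjπ V W

instance : Epi (relProj V W) := inferInstanceAs (Epi (relTensorObjπ V W))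

theorem ract_relProj :
    V.ract ▷ W.X ≫ relProj V W = (α_ V.X A W.X).hom ≫ V.X ◁ W.act ≫ relProj V W :=
  ract_relTensorObjπ V W

theorem isBalanced_relProj : IsBalanced V W (relProj V W) := ract_relProj V W

theorem relProj_condition :
    V.ract ▷ W.X ≫ relProj V W = ((α_ V.X A W.X).hom ≫ V.X ◁ W.act) ≫ relProj V W :=
  relTensorObjπ_condition V W

noncomputable def relProjIsColimit : IsColimit (Cofork.ofπ (relProj V W) (relProj_condition V W)) :=
  relTensorObjIsColimit V W

variable {V W}

/-- The morphism out of `V ⊗_A W` induced by a balanced morphism. -/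
noncomputable def relDesc {Z : C} (f : V.X ⊗ W.X ⟶ Z) (hf : IsBalanced V W f) :
    (relTensor V W).X ⟶ Z :=
  coequalizer.desc f (by rw [Category.assoc]; exact hf)

@[simp]
theorem relProj_relDesc {Z : C} (f : V.X ⊗ W.X ⟶ Z) (hf : IsBalanced V W f) :
    relProj V W ≫ relDesc f hf = f :=
  coequalizer.π_desc _ _

@[simp]
theorem relProj_relDesc_assoc {Z : C} (f : V.X ⊗ W.X ⟶ Z) (hf : IsBalanced V W f)
    {Z₀ : C} (k : _ ⟶ Z₀) :
    relProj V W ≫ relDesc f hf ≫ k =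
      f ≫ k :=
  (reassoc_of% (relProj_relDesc f hf)) k

theorem relProj_act : A ◁ relProj V W ≫ (relTensor V W).act =
    (α_ A V.X W.X).inv ≫ V.act ▷ W.X ≫ relProj V W :=
  (exists_relTensor_act V W).choose_spec

theorem relProj_act_assoc
    {Z₀ : C} (k : _ ⟶ Z₀) :
    A ◁ relProj V W ≫ (relTensor V W).act ≫ k =
      (α_ A V.X W.X).inv ≫ V.act ▷ W.X ≫ relProj V W ≫ k :=
  (reassoc_of% relProj_act) k

/-- The left action is on `V`, so transporting it to the right means braiding `A` past `V` and `W`;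
balancedness carries the action across from `V` to `W`, where it becomes the right action. -/
theorem relProj_ract : relProj V W ▷ A ≫ (relTensor V W).ract =
    (α_ V.X W.X A).hom ≫ V.X ◁ W.ract ≫ relProj V W := by
  rw [← cancel_epi (β_ A (V.X ⊗ W.X)).hom, ← BraidedCategory.braiding_naturality_right_assoc,
    Mod.braiding_ract, relProj_act, BraidedCategory.braiding_tensor_right_hom]
  simp only [Category.assoc, Iso.inv_hom_id_assoc]
  rw [← whiskerLeft_comp_assoc, Mod.braiding_ract, ← ract_relProj, ← comp_whiskerRight_assoc,
    Mod.braiding_ract]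

theorem isRelTensor_relProj : IsRelTensor V W (relTensor V W) (relProj V W) where
  balanced := isBalanced_iff.1 (isBalanced_relProj V W)
  isColimit := ⟨Cofork.IsColimit.mk _ (fun s => relDesc s.π (isBalanced_iff.2 s.condition))
    (fun s => relProj_relDesc _ _)
    (fun s m hm => (cancel_epi (relProj V W)).1 (hm.trans (relProj_relDesc _ _).symm))⟩
  act := by rw [relProj_act, relAct₁, Category.assoc]

/-- A morphism out of `V ⊗_A W` is semilinear if its restriction to `V ⊗ W` is. -/
theorem isSemilinear_relTensor {a : A ⟶ A} {Z : Mod C A} {f : (relTensor V W).X ⟶ Z.X}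
    (h : V.act ▷ W.X ≫ relProj V W ≫ f =
      (α_ A V.X W.X).hom ≫ (a ⊗ₘ (relProj V W ≫ f)) ≫ Z.act) :
    IsSemilinear a f := by
  unfold IsSemilinear
  rw [← cancel_epi (A ◁ relProj V W), relProj_act_assoc, h, Iso.inv_hom_id_assoc,
    whiskerLeft_comp_tensorHom_assoc]

/-- The morphism `V ⊗_A W ⟶ V' ⊗_A W'` induced by a pair of semilinear morphisms. -/
noncomputable def relMap (a : A ⟶ A) {V' W' : Mod C A} {f : V.X ⟶ V'.X} {g : W.X ⟶ W'.X}
    (hf : IsSemilinear a f) (hg : IsSemilinear a g) : (relTensor V W).X ⟶ (relTensor V' W').X :=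
  relDesc ((f ⊗ₘ g) ≫ relProj V' W') (isBalanced_tensorHom hf hg (isBalanced_relProj V' W'))

@[simp]
theorem relProj_relMap (a : A ⟶ A) {V' W' : Mod C A} {f : V.X ⟶ V'.X} {g : W.X ⟶ W'.X}
    (hf : IsSemilinear a f) (hg : IsSemilinear a g) :
    relProj V W ≫ relMap a hf hg = (f ⊗ₘ g) ≫ relProj V' W' :=
  relProj_relDesc _ _

@[simp]
theorem relProj_relMap_assoc (a : A ⟶ A) {V' W' : Mod C A} {f : V.X ⟶ V'.X} {g : W.X ⟶ W'.X}
    (hf : IsSemilinear a f) (hg : IsSemilinear a g) {Z₀ : C} (k : _ ⟶ Z₀) :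
    relProj V W ≫ relMap a hf hg ≫ k =
      (f ⊗ₘ g) ≫ relProj V' W' ≫ k :=
  (reassoc_of% (relProj_relMap a hf hg)) k

theorem isSemilinear_relMap (a : A ⟶ A) {V' W' : Mod C A} {f : V.X ⟶ V'.X} {g : W.X ⟶ W'.X}
    (hf : IsSemilinear a f) (hg : IsSemilinear a g) : IsSemilinear a (relMap a hf hg) := by
  apply isSemilinear_relTensor
  rw [relProj_relMap]
  have h1 : V.act ▷ W.X ≫ (f ⊗ₘ g) = ((a ⊗ₘ f) ⊗ₘ g) ≫ V'.act ▷ W'.X := by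
    unfold IsSemilinear at hf
    rw [whiskerRight_comp_tensorHom, hf, tensorHom_comp_whiskerRight]
  rw [reassoc_of% h1, ← tensorHom_comp_whiskerLeft_assoc, relProj_act,
    associator_inv_naturality_assoc, Iso.hom_inv_id_assoc]

/-- Morphisms out of `V ⊗_A W` agree if they agree on `V ⊗ W`. -/
theorem relTensor_hom_ext {Z : C} {f g : (relTensor V W).X ⟶ Z}
    (h : relProj V W ≫ f = relProj V W ≫ g) : f = g :=
  (cancel_epi (relProj V W)).1 h

end RelTensor

/-! ### Associativity of the tensor product over `A`. -/

section Assoc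

variable {C : Type u} [Category.{v} C] [MonoidalCategory C] [BraidedCategory C] {A : C} [MonObj A]
  [IsCommMonObj A] [HasCoequalizers C] [RigidCategory C] (U V W : Mod C A)

/-- One factor is descended at a time: `- ⊗ W` preserves the coequalizer defining `U ⊗_A V`, and the
second descent, to `(U ⊗_A V) ⊗_A W`, is `isBalanced_relAssoc_hom`. -/
theorem exists_relAssoc_hom :
    ∃ f : (relTensor U V).X ⊗ W.X ⟶ (relTensor U (relTensor V W)).X,
      relProj U V ▷ W.X ≫ f = (α_ _ _ _).hom ≫ U.X ◁ relProj V W ≫ relProj U (relTensor V W) := by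
  refine exists_whiskerRight_desc (relProjIsColimit U V) W.X _ ?_
  calc _ = 𝟙 _ ⊗≫ (U.ract ▷ (V.X ⊗ W.X) ≫ U.X ◁ relProj V W) ≫ relProj U (relTensor V W) := by
        monoidal
    _ = 𝟙 _ ⊗≫ (U.X ⊗ A) ◁ relProj V W ≫
          (U.ract ▷ (relTensor V W).X ≫ relProj U (relTensor V W)) := by
        rw [← whisker_exchange]; monoidal
    _ = 𝟙 _ ⊗≫ U.X ◁ (A ◁ relProj V W ≫ (relTensor V W).act) ≫ relProj U (relTensor V W) := by
        rw [ract_relProj]; monoidal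
    _ = _ := by rw [relProj_act]; monoidal

theorem exists_relAssoc_inv :
    ∃ f : U.X ⊗ (relTensor V W).X ⟶ (relTensor (relTensor U V) W).X,
      U.X ◁ relProj V W ≫ f = (α_ _ _ _).inv ≫ relProj U V ▷ W.X ≫ relProj (relTensor U V) W := by
  refine exists_whiskerLeft_desc (relProjIsColimit V W) U.X _ ?_
  calc _ = 𝟙 _ ⊗≫ ((α_ U.X V.X A).hom ≫ U.X ◁ V.ract ≫ relProj U V) ▷ W.X ≫
          relProj (relTensor U V) W := by monoidal
    _ = 𝟙 _ ⊗≫ relProj U V ▷ A ▷ W.X ≫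
          ((relTensor U V).ract ▷ W.X ≫ relProj (relTensor U V) W) := by
        rw [← relProj_ract]; monoidal
    _ = 𝟙 _ ⊗≫ (relProj U V ▷ (A ⊗ W.X) ≫ (relTensor U V).X ◁ W.act) ≫
          relProj (relTensor U V) W := by
        rw [ract_relProj]; monoidal
    _ = _ := by rw [← whisker_exchange]; monoidal

variable {U V W}

theorem isBalanced_relAssoc_hom {f : (relTensor U V).X ⊗ W.X ⟶ (relTensor U (relTensor V W)).X}
    (hf : relProj U V ▷ W.X ≫ f =
      (α_ _ _ _).hom ≫ U.X ◁ relProj V W ≫ relProj U (relTensor V W)) :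
    IsBalanced (relTensor U V) W f := by
  unfold IsBalanced
  rw [← cancel_epi (relProj U V ▷ A ▷ W.X), ← comp_whiskerRight_assoc, relProj_ract]
  calc _ = 𝟙 _ ⊗≫ U.X ◁ V.ract ▷ W.X ⊗≫ (relProj U V ▷ W.X ≫ f) := by monoidal
    _ = 𝟙 _ ⊗≫ U.X ◁ (V.ract ▷ W.X ≫ relProj V W) ≫ relProj U (relTensor V W) := by
        rw [hf]; monoidal
    _ = 𝟙 _ ⊗≫ (U.X ⊗ V.X) ◁ W.act ≫
          ((α_ _ _ _).hom ≫ U.X ◁ relProj V W ≫ relProj U (relTensor V W)) := by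
        rw [ract_relProj]; monoidal
    _ = 𝟙 _ ⊗≫ ((U.X ⊗ V.X) ◁ W.act ≫ relProj U V ▷ W.X) ≫ f := by rw [← hf]; monoidal
    _ = _ := by rw [whisker_exchange]; monoidal

theorem linear_relAssoc_hom {f : (relTensor U V).X ⊗ W.X ⟶ (relTensor U (relTensor V W)).X}
    (hf : relProj U V ▷ W.X ≫ f =
      (α_ _ _ _).hom ≫ U.X ◁ relProj V W ≫ relProj U (relTensor V W)) :
    (relTensor U V).act ▷ W.X ≫ f =
      (α_ _ _ _).hom ≫ A ◁ f ≫ (relTensor U (relTensor V W)).act := by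
  rw [← cancel_epi ((A ◁ relProj U V) ▷ W.X), ← comp_whiskerRight_assoc, relProj_act]
  calc _ = 𝟙 _ ⊗≫ U.act ▷ V.X ▷ W.X ≫ (relProj U V ▷ W.X ≫ f) := by monoidal
    _ = 𝟙 _ ⊗≫ (U.act ▷ (V.X ⊗ W.X) ≫ U.X ◁ relProj V W) ≫ relProj U (relTensor V W) := by
        rw [hf]; monoidal
    _ = 𝟙 _ ⊗≫ (A ⊗ U.X) ◁ relProj V W ⊗≫
          ((α_ _ _ _).inv ≫ U.act ▷ (relTensor V W).X ≫ relProj U (relTensor V W)) := by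
        rw [← whisker_exchange]; monoidal
    _ = 𝟙 _ ⊗≫ A ◁ ((α_ _ _ _).hom ≫ U.X ◁ relProj V W ≫ relProj U (relTensor V W)) ≫
          (relTensor U (relTensor V W)).act := by
        rw [← relProj_act]; monoidal
    _ = _ := by rw [← hf]; monoidal

/-- Balancedness is all that is asked of the inverse associator: an inverse in `C` of a linear
equivariant map is itself linear and equivariant (`isoOfInv`). -/
theorem isBalanced_relAssoc_inv {f : U.X ⊗ (relTensor V W).X ⟶ (relTensor (relTensor U V) W).X}
    (hf : U.X ◁ relProj V W ≫ f =
      (α_ _ _ _).inv ≫ relProj U V ▷ W.X ≫ relProj (relTensor U V) W) :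
    IsBalanced U (relTensor V W) f := by
  unfold IsBalanced
  rw [← cancel_epi ((U.X ⊗ A) ◁ relProj V W), whisker_exchange_assoc, hf]
  calc _ = 𝟙 _ ⊗≫ (U.ract ▷ V.X ≫ relProj U V) ▷ W.X ≫ relProj (relTensor U V) W := by monoidal
    _ = 𝟙 _ ⊗≫ (U.X ◁ V.act) ▷ W.X ⊗≫
          ((α_ _ _ _).inv ≫ relProj U V ▷ W.X ≫ relProj (relTensor U V) W) := by
        rw [ract_relProj]; monoidal
    _ = 𝟙 _ ⊗≫ (U.X ◁ V.act) ▷ W.X ⊗≫ U.X ◁ relProj V W ≫ f := by rw [← hf]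
    _ = 𝟙 _ ⊗≫ U.X ◁ ((α_ _ _ _).inv ≫ V.act ▷ W.X ≫ relProj V W) ≫ f := by monoidal
    _ = _ := by rw [← relProj_act]; monoidal

end Assoc

/-! ### Tensor product, associator and unitors of `𝒟`. -/

namespace EquivMod

variable {C : Type u} [Category.{v} C] [MonoidalCategory C] {G : Type w} [Group G] {A : C}
  [MonObj A] {π : AlgAction G A}

/-- The morphism of `𝒟` given by a linear equivariant morphism of `C`. -/
def mkHom {V W : EquivMod π} (f : V.X ⟶ W.X) (hf : IsSemilinear (V := V.M) (W := W.M) (𝟙 A) f)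
    (hG : ∀ g, V.ρ g ≫ f = f ≫ W.ρ g) : V ⟶ W :=
  ⟨Mod.Hom.mk' f (by unfold IsSemilinear at hf; rw [id_tensorHom] at hf; exact hf), hG⟩

theorem isSemilinear_toC {V W : EquivMod π} (f : V ⟶ W) :
    IsSemilinear (V := V.M) (W := W.M) (𝟙 A) (toC f) :=
  isSemilinear_hom f.hom

theorem act_toC {V W : EquivMod π} (f : V ⟶ W) : V.M.act ≫ toC f = A ◁ toC f ≫ W.M.act :=
  f.hom.isModHom.smul_hom

theorem act_toC_assoc {V W : EquivMod π} (f : V ⟶ W)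
    {Z₀ : C} (k : _ ⟶ Z₀) :
    V.M.act ≫ toC f ≫ k =
      A ◁ toC f ≫ W.M.act ≫ k :=
  (reassoc_of% (act_toC f)) k

theorem ρ_toC {V W : EquivMod π} (f : V ⟶ W) (g : G) : V.ρ g ≫ toC f = toC f ≫ W.ρ g :=
  f.comm g

theorem ρ_toC_assoc {V W : EquivMod π} (f : V ⟶ W) (g : G)
    {Z₀ : C} (k : _ ⟶ Z₀) :
    V.ρ g ≫ toC f ≫ k =
      toC f ≫ W.ρ g ≫ k :=
  (reassoc_of% (ρ_toC f g)) k

theorem isSemilinear_ρ (V : EquivMod π) (g : G) :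
    IsSemilinear (V := V.M) (W := V.M) (π.π g) (V.ρ g) :=
  V.compat g

theorem ρ_one (V : EquivMod π) : V.ρ 1 = 𝟙 V.X := V.φ.map_one

theorem ρ_mul (V : EquivMod π) (g h : G) : V.ρ (g * h) = V.ρ h ≫ V.ρ g := V.φ.map_mul g h

/-- An isomorphism of `𝒟` from a morphism whose underlying morphism of `C` has an inverse. -/
@[simps hom]
def isoOfInv {V W : EquivMod π} (f : V ⟶ W) (i : W.X ⟶ V.X) (h₁ : toC f ≫ i = 𝟙 _)
    (h₂ : i ≫ toC f = 𝟙 _) : V ≅ W where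
  hom := f
  inv := mkHom i
    (by
      rw [isSemilinear_id_iff]
      -- Sandwiching the linearity of `f` between copies of its inverse gives the linearity of `i`;
      -- equivariance is obtained the same way.
      have h := congrArg (fun x => A ◁ i ≫ x ≫ i) (act_toC f)
      simp only [Category.assoc, h₁, Category.comp_id] at h
      rw [h, ← whiskerLeft_comp_assoc, h₂, whiskerLeft_id, Category.id_comp])
    (fun g => by
      have h := congrArg (fun x => i ≫ x ≫ i) (ρ_toC f g)
      simp only [Category.assoc, h₁, Category.comp_id] at h
      rw [h, reassoc_of% h₂])
  hom_inv_id := hom_ext' h₁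
  inv_hom_id := hom_ext' h₂

variable [BraidedCategory C] [IsCommMonObj A] [HasCoequalizers C] [RigidCategory C]

variable (π) in
/-- The unit object `(A, π)` of `𝒟`. -/
abbrev oneObj : EquivMod π where
  M := Mod.unit A
  φ := π.π
  compat g := (π.isMonHom g).mul_hom

/-- The tensor product `(V ⊗_A W, φ_V ⊗ φ_W)` of `𝒟`. -/
noncomputable abbrev tensor (V W : EquivMod π) : EquivMod π where
  M := relTensor V.M W.M
  φ :=
    { toFun := fun g => relMap (π.π g) (V.isSemilinear_ρ g) (W.isSemilinear_ρ g)
      map_one' := relTensor_hom_ext (by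
        change _ = relProj V.M W.M ≫ 𝟙 _
        rw [relProj_relMap, ρ_one, ρ_one, id_tensorHom_id, Category.id_comp, Category.comp_id])
      map_mul' := fun g h => relTensor_hom_ext (by
        change _ = relProj V.M W.M ≫ relMap _ _ _ ≫ relMap _ _ _
        rw [relProj_relMap, relProj_relMap_assoc, relProj_relMap, ρ_mul, ρ_mul,
          ← tensorHom_comp_tensorHom_assoc]) }
  compat g := isSemilinear_relMap (π.π g) (V.isSemilinear_ρ g) (W.isSemilinear_ρ g)

/-- The projection `V ⊗ W ⟶ V ⊗_A W`. -/
noncomputable def proj (V W : EquivMod π) : V.X ⊗ W.X ⟶ (tensor V W).X := relProj V.M W.M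

instance (V W : EquivMod π) : Epi (proj V W) := inferInstanceAs (Epi (relProj V.M W.M))

theorem proj_ρ (V W : EquivMod π) (g : G) :
    proj V W ≫ (tensor V W).ρ g = (V.ρ g ⊗ₘ W.ρ g) ≫ proj V W :=
  relProj_relMap (π.π g) (V.isSemilinear_ρ g) (W.isSemilinear_ρ g)

theorem proj_ρ_assoc (V W : EquivMod π) (g : G)
    {Z₀ : C} (k : _ ⟶ Z₀) :
    proj V W ≫ (tensor V W).ρ g ≫ k =
      (V.ρ g ⊗ₘ W.ρ g) ≫ proj V W ≫ k :=
  (reassoc_of% (proj_ρ V W g)) k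

theorem proj_act (V W : EquivMod π) : A ◁ proj V W ≫ (tensor V W).M.act =
    (α_ A V.X W.X).inv ≫ V.M.act ▷ W.X ≫ proj V W :=
  relProj_act

theorem proj_ract (V W : EquivMod π) : proj V W ▷ A ≫ (tensor V W).M.ract =
    (α_ V.X W.X A).hom ≫ V.X ◁ W.M.ract ≫ proj V W :=
  relProj_ract

theorem ract_proj (V W : EquivMod π) : V.M.ract ▷ W.X ≫ proj V W =
    (α_ V.X A W.X).hom ≫ V.X ◁ W.M.act ≫ proj V W :=
  ract_relProj V.M W.M

/-- The morphism of `𝒟` out of `V ⊗_A W` induced by a balanced, linear, equivariant morphism. -/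
noncomputable def tensorDesc {V W Z : EquivMod π} (f : V.X ⊗ W.X ⟶ Z.X)
    (hb : IsBalanced V.M W.M f) (hl : V.M.act ▷ W.X ≫ f = (α_ _ _ _).hom ≫ A ◁ f ≫ Z.M.act)
    (hG : ∀ g, (V.ρ g ⊗ₘ W.ρ g) ≫ f = f ≫ Z.ρ g) : tensor V W ⟶ Z :=
  mkHom (relDesc f hb)
    (isSemilinear_relTensor (by rw [relProj_relDesc, id_tensorHom, hl]))
    (fun g => (cancel_epi (proj V W)).1 (by
      rw [proj_ρ_assoc, proj, relProj_relDesc, hG, relProj_relDesc_assoc]))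

@[simp]
theorem proj_tensorDesc {V W Z : EquivMod π} (f : V.X ⊗ W.X ⟶ Z.X)
    (hb : IsBalanced V.M W.M f) (hl : V.M.act ▷ W.X ≫ f = (α_ _ _ _).hom ≫ A ◁ f ≫ Z.M.act)
    (hG : ∀ g, (V.ρ g ⊗ₘ W.ρ g) ≫ f = f ≫ Z.ρ g) : proj V W ≫ toC (tensorDesc f hb hl hG) = f :=
  relProj_relDesc f hb

/-- The tensor product of morphisms of `𝒟`. -/
noncomputable def tensorMap {V V' W W' : EquivMod π} (f : V ⟶ V') (g : W ⟶ W') :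
    tensor V W ⟶ tensor V' W' :=
  mkHom (relMap (𝟙 A) (isSemilinear_toC f) (isSemilinear_toC g)) (isSemilinear_relMap _ _ _)
    (fun x => (cancel_epi (proj V W)).1 (by
      rw [proj_ρ_assoc, proj, relProj_relMap, relProj_relMap_assoc, ← proj, proj_ρ,
        tensorHom_comp_tensorHom_assoc, tensorHom_comp_tensorHom_assoc, ρ_toC, ρ_toC]))

@[simp]
theorem proj_tensorMap {V V' W W' : EquivMod π} (f : V ⟶ V') (g : W ⟶ W') :
    proj V W ≫ toC (tensorMap f g) = (toC f ⊗ₘ toC g) ≫ proj V' W' :=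
  relProj_relMap (𝟙 A) (isSemilinear_toC f) (isSemilinear_toC g)

theorem exists_assoc (U V W : EquivMod π) : ∃ a : tensor (tensor U V) W ≅ tensor U (tensor V W),
    proj U V ▷ W.X ≫ proj (tensor U V) W ≫ toC a.hom =
      (α_ U.X V.X W.X).hom ≫ U.X ◁ proj V W ≫ proj U (tensor V W) := by
  obtain ⟨f, hf⟩ := exists_relAssoc_hom U.M V.M W.M
  obtain ⟨i, hi⟩ := exists_relAssoc_inv U.M V.M W.M
  let F : tensor (tensor U V) W ⟶ tensor U (tensor V W) :=
    tensorDesc f (isBalanced_relAssoc_hom hf) (linear_relAssoc_hom hf) (fun g => by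
      change proj U V ▷ W.X ≫ f = (α_ _ _ _).hom ≫ U.X ◁ proj V W ≫ proj U (tensor V W) at hf
      rw [← cancel_epi (proj U V ▷ W.X), whiskerRight_comp_tensorHom_assoc, proj_ρ,
        reassoc_of% hf, proj_ρ, whiskerLeft_comp_tensorHom_assoc, proj_ρ V W,
        ← tensorHom_comp_whiskerRight_assoc, hf, associator_naturality_assoc,
        tensorHom_comp_whiskerLeft_assoc])
  have hF : proj U V ▷ W.X ≫ proj (tensor U V) W ≫ toC F =
      (α_ U.X V.X W.X).hom ≫ U.X ◁ proj V W ≫ proj U (tensor V W) := by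
    rw [proj_tensorDesc]; exact hf
  let I : (tensor U (tensor V W)).X ⟶ (tensor (tensor U V) W).X :=
    relDesc i (isBalanced_relAssoc_inv hi)
  have hI : U.X ◁ proj V W ≫ proj U (tensor V W) ≫ I =
      (α_ U.X V.X W.X).inv ≫ proj U V ▷ W.X ≫ proj (tensor U V) W :=
    (congrArg (U.X ◁ proj V W ≫ ·) (relProj_relDesc _ _)).trans hi
  refine ⟨isoOfInv F I ?_ ?_, hF⟩
  · rw [← cancel_epi (proj (tensor U V) W), ← cancel_epi (proj U V ▷ W.X), reassoc_of% hF, hI]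
    simp
  · rw [← cancel_epi (proj U (tensor V W)), ← cancel_epi (U.X ◁ proj V W), reassoc_of% hI, hF]
    simp

noncomputable def assoc (U V W : EquivMod π) : tensor (tensor U V) W ≅ tensor U (tensor V W) :=
  (exists_assoc U V W).choose

theorem proj_assoc (U V W : EquivMod π) :
    proj U V ▷ W.X ≫ proj (tensor U V) W ≫ toC (assoc U V W).hom =
      (α_ U.X V.X W.X).hom ≫ U.X ◁ proj V W ≫ proj U (tensor V W) :=
  (exists_assoc U V W).choose_spec

theorem exists_leftUnitor (V : EquivMod π) : ∃ l : tensor (oneObj π) V ≅ V,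
    proj (oneObj π) V ≫ toC l.hom = V.M.act := by
  let F : tensor (oneObj π) V ⟶ V := tensorDesc V.M.act
    (by
      unfold IsBalanced
      rw [Mod.unit_ract]
      exact V.M.mul_act)
    V.M.mul_act (fun g => (V.compat g).symm)
  have hF : proj (oneObj π) V ≫ toC F = V.M.act := proj_tensorDesc _ _ _ _
  -- The inverse is `v ↦ 1 ⊗ v`; that it inverts the action uses `a ⊗ v = 1 ⊗ av` in `A ⊗_A V`.
  refine ⟨isoOfInv F ((λ_ _).inv ≫ η[A] ▷ V.X ≫ proj (oneObj π) V) ?_ ?_, hF⟩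
  · rw [← cancel_epi (proj (oneObj π) V), reassoc_of% hF, leftUnitor_inv_naturality_assoc,
      whisker_exchange_assoc]
    have h := ract_proj (oneObj π) V
    rw [Mod.unit_ract] at h
    calc _ = 𝟙 _ ⊗≫ η[A] ▷ (A ⊗ V.X) ⊗≫
          ((α_ A A V.X).hom ≫ A ◁ V.M.act ≫ proj (oneObj π) V) := by monoidal
      _ = 𝟙 _ ⊗≫ (η[A] ▷ A ≫ μ[A]) ▷ V.X ≫ proj (oneObj π) V := by
        rw [← h]; monoidal
      _ = _ := by rw [MonObj.one_mul]; monoidal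
  · simp only [Category.assoc]
    rw [hF, Mod.one_act, Iso.inv_hom_id]

noncomputable def leftUnit (V : EquivMod π) : tensor (oneObj π) V ≅ V :=
  (exists_leftUnitor V).choose

theorem proj_leftUnit (V : EquivMod π) :
    proj (oneObj π) V ≫ toC (leftUnit V).hom = V.M.act :=
  (exists_leftUnitor V).choose_spec

theorem exists_rightUnitor (V : EquivMod π) : ∃ l : tensor V (oneObj π) ≅ V,
    proj V (oneObj π) ≫ toC l.hom = V.M.ract := by
  have hb : IsBalanced V.M (oneObj π).M V.M.ract := by
    unfold IsBalanced
    rw [← cancel_epi (α_ V.X A A).inv, Iso.inv_hom_id_assoc]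
    exact V.M.mul_ract.symm
  let F : tensor V (oneObj π) ⟶ V := tensorDesc V.M.ract hb V.M.act_ract
    (fun g => ((V.isSemilinear_ρ g).ract).symm)
  have hF : proj V (oneObj π) ≫ toC F = V.M.ract := proj_tensorDesc _ _ _ _
  refine ⟨isoOfInv F ((ρ_ _).inv ≫ V.X ◁ η[A] ≫ proj V (oneObj π)) ?_ ?_, hF⟩
  · have h := ract_proj V (oneObj π)
    change V.M.ract ▷ A ≫ _ = _ ≫ V.X ◁ μ[A] ≫ _ at h
    rw [← cancel_epi (proj V (oneObj π)), reassoc_of% hF, rightUnitor_inv_naturality_assoc,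
      ← whisker_exchange_assoc, h]
    calc _ = 𝟙 _ ⊗≫ V.X ◁ (A ◁ η[A] ≫ μ[A]) ≫ proj V (oneObj π) := by
          monoidal
      _ = _ := by rw [MonObj.mul_one]; monoidal
  · simp only [Category.assoc]
    rw [hF, Mod.one_ract, Iso.inv_hom_id]

noncomputable def rightUnit (V : EquivMod π) : tensor V (oneObj π) ≅ V :=
  (exists_rightUnitor V).choose

theorem proj_rightUnit (V : EquivMod π) :
    proj V (oneObj π) ≫ toC (rightUnit V).hom = V.M.ract :=
  (exists_rightUnitor V).choose_spec

end EquivMod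

/-! ### The monoidal category `𝒟`. -/

namespace EquivMod

variable {C : Type u} [Category.{v} C] [MonoidalCategory C] {G : Type w} [Group G] {A : C}
  [MonObj A] {π : AlgAction G A} [BraidedCategory C] [IsCommMonObj A] [HasCoequalizers C]
  [RigidCategory C]

noncomputable instance : MonoidalCategoryStruct (EquivMod π) where
  tensorObj := tensor
  tensorHom := tensorMap
  whiskerLeft V _ _ f := tensorMap (𝟙 V) f
  whiskerRight f W := tensorMap f (𝟙 W)
  tensorUnit := oneObj π
  associator := assoc
  leftUnitor := leftUnit
  rightUnitor := rightUnit

/-- The projection `V ⊗ W ⟶ V ⊗_A W` onto the tensor product of `𝒟`. -/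
noncomputable def pr (V W : EquivMod π) : V.X ⊗ W.X ⟶ (V ⊗ W).X := proj V W

instance (V W : EquivMod π) : Epi (pr V W) := inferInstanceAs (Epi (proj V W))

theorem pr_ext {V W : EquivMod π} {Z : C} {f g : (V ⊗ W).X ⟶ Z} (h : pr V W ≫ f = pr V W ≫ g) :
    f = g :=
  (cancel_epi (pr V W)).1 h

theorem tensorObj_ext {V W Z : EquivMod π} {f g : V ⊗ W ⟶ Z}
    (h : pr V W ≫ toC f = pr V W ≫ toC g) : f = g :=
  hom_ext' (pr_ext h)

theorem pr_pr_ext {U V W : EquivMod π} {Z : C} {f g : ((U ⊗ V) ⊗ W).X ⟶ Z}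
    (h : pr U V ▷ W.X ≫ pr (U ⊗ V) W ≫ f = pr U V ▷ W.X ≫ pr (U ⊗ V) W ≫ g) : f = g :=
  pr_ext ((cancel_epi (pr U V ▷ W.X)).1 h)

@[simp]
theorem pr_tensorHom {V V' W W' : EquivMod π} (f : V ⟶ V') (g : W ⟶ W') :
    pr V W ≫ toC (f ⊗ₘ g) = (toC f ⊗ₘ toC g) ≫ pr V' W' :=
  proj_tensorMap f g

@[simp]
theorem pr_tensorHom_assoc {V V' W W' : EquivMod π} (f : V ⟶ V') (g : W ⟶ W')
    {Z₀ : C} (k : _ ⟶ Z₀) :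
    pr V W ≫ toC (f ⊗ₘ g) ≫ k =
      (toC f ⊗ₘ toC g) ≫ pr V' W' ≫ k :=
  (reassoc_of% (pr_tensorHom f g)) k

@[simp]
theorem pr_whiskerLeft (V : EquivMod π) {W W' : EquivMod π} (g : W ⟶ W') :
    pr V W ≫ toC (V ◁ g) = V.X ◁ toC g ≫ pr V W' :=
  (proj_tensorMap (𝟙 V) g).trans (by rw [toC_id, id_tensorHom]; rfl)

@[simp]
theorem pr_whiskerLeft_assoc (V : EquivMod π) {W W' : EquivMod π} (g : W ⟶ W')
    {Z₀ : C} (k : _ ⟶ Z₀) :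
    pr V W ≫ toC (V ◁ g) ≫ k =
      V.X ◁ toC g ≫ pr V W' ≫ k :=
  (reassoc_of% (pr_whiskerLeft V g)) k

@[simp]
theorem pr_whiskerRight {V V' : EquivMod π} (f : V ⟶ V') (W : EquivMod π) :
    pr V W ≫ toC (f ▷ W) = toC f ▷ W.X ≫ pr V' W :=
  (proj_tensorMap f (𝟙 W)).trans (by rw [toC_id, tensorHom_id]; rfl)

@[simp]
theorem pr_whiskerRight_assoc {V V' : EquivMod π} (f : V ⟶ V') (W : EquivMod π)
    {Z₀ : C} (k : _ ⟶ Z₀) :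
    pr V W ≫ toC (f ▷ W) ≫ k =
      toC f ▷ W.X ≫ pr V' W ≫ k :=
  (reassoc_of% (pr_whiskerRight f W)) k

@[simp]
theorem pr_associator (U V W : EquivMod π) :
    pr U V ▷ W.X ≫ pr (U ⊗ V) W ≫ toC (α_ U V W).hom =
      (α_ U.X V.X W.X).hom ≫ U.X ◁ pr V W ≫ pr U (V ⊗ W) :=
  proj_assoc U V W

@[simp]
theorem pr_associator_assoc (U V W : EquivMod π)
    {Z₀ : C} (k : _ ⟶ Z₀) :
    pr U V ▷ W.X ≫ pr (U ⊗ V) W ≫ toC (α_ U V W).hom ≫ k =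
      (α_ U.X V.X W.X).hom ≫ U.X ◁ pr V W ≫ pr U (V ⊗ W) ≫ k :=
  (reassoc_of% (pr_associator U V W)) k

@[simp]
theorem pr_leftUnitor (V : EquivMod π) : pr (𝟙_ (EquivMod π)) V ≫ toC (λ_ V).hom = V.M.act :=
  proj_leftUnit V

@[simp]
theorem pr_leftUnitor_assoc (V : EquivMod π)
    {Z₀ : C} (k : _ ⟶ Z₀) :
    pr (𝟙_ (EquivMod π)) V ≫ toC (λ_ V).hom ≫ k =
      V.M.act ≫ k :=
  (reassoc_of% (pr_leftUnitor V)) k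

@[simp]
theorem pr_rightUnitor (V : EquivMod π) : pr V (𝟙_ (EquivMod π)) ≫ toC (ρ_ V).hom = V.M.ract :=
  proj_rightUnit V

@[simp]
theorem pr_rightUnitor_assoc (V : EquivMod π)
    {Z₀ : C} (k : _ ⟶ Z₀) :
    pr V (𝟙_ (EquivMod π)) ≫ toC (ρ_ V).hom ≫ k =
      V.M.ract ≫ k :=
  (reassoc_of% (pr_rightUnitor V)) k

theorem pr_ρ (V W : EquivMod π) (g : G) :
    pr V W ≫ (V ⊗ W).ρ g = (V.ρ g ⊗ₘ W.ρ g) ≫ pr V W :=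
  proj_ρ V W g

theorem pr_ρ_assoc (V W : EquivMod π) (g : G)
    {Z₀ : C} (k : _ ⟶ Z₀) :
    pr V W ≫ (V ⊗ W).ρ g ≫ k =
      (V.ρ g ⊗ₘ W.ρ g) ≫ pr V W ≫ k :=
  (reassoc_of% (pr_ρ V W g)) k

theorem pr_act (V W : EquivMod π) : A ◁ pr V W ≫ (V ⊗ W).M.act =
    (α_ A V.X W.X).inv ≫ V.M.act ▷ W.X ≫ pr V W :=
  proj_act V W

theorem pr_act_assoc (V W : EquivMod π)
    {Z₀ : C} (k : _ ⟶ Z₀) :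
    A ◁ pr V W ≫ (V ⊗ W).M.act ≫ k =
      (α_ A V.X W.X).inv ≫ V.M.act ▷ W.X ≫ pr V W ≫ k :=
  (reassoc_of% (pr_act V W)) k

theorem pr_ract (V W : EquivMod π) : pr V W ▷ A ≫ (V ⊗ W).M.ract =
    (α_ V.X W.X A).hom ≫ V.X ◁ W.M.ract ≫ pr V W :=
  proj_ract V W

theorem pr_ract_assoc (V W : EquivMod π)
    {Z₀ : C} (k : _ ⟶ Z₀) :
    pr V W ▷ A ≫ (V ⊗ W).M.ract ≫ k =
      (α_ V.X W.X A).hom ≫ V.X ◁ W.M.ract ≫ pr V W ≫ k :=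
  (reassoc_of% (pr_ract V W)) k

theorem ract_pr (V W : EquivMod π) : V.M.ract ▷ W.X ≫ pr V W =
    (α_ V.X A W.X).hom ≫ V.X ◁ W.M.act ≫ pr V W :=
  ract_proj V W

/-- Each axiom is tested on a tensor product in `C` through composites of projections, which are
epimorphisms. Pentagon and associator naturality then reduce to those of `C`, and unitor naturality
to linearity of morphisms. -/
noncomputable instance : MonoidalCategory (EquivMod π) :=
  MonoidalCategory.ofTensorHom
    (id_tensorHom_id := fun V W => tensorObj_ext (by simp))
    (id_tensorHom := fun _ _ _ _ => rfl)
    (tensorHom_id := fun _ _ => rfl)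
    (tensorHom_comp_tensorHom := fun _ _ _ _ => tensorObj_ext (by simp))
    (associator_naturality := fun {U V W U' V' W'} f g h => hom_ext' (pr_pr_ext (by
      simp only [toC_comp, pr_tensorHom_assoc, pr_associator_assoc, pr_tensorHom,
        whiskerRight_comp_tensorHom_assoc]
      rw [← tensorHom_comp_whiskerRight_assoc, pr_associator, associator_naturality_assoc,
        whiskerLeft_comp_tensorHom_assoc, pr_tensorHom, tensorHom_comp_whiskerLeft_assoc])))
    (leftUnitor_naturality := fun {V W} f => tensorObj_ext (by
      simp only [toC_comp, pr_tensorHom_assoc, pr_leftUnitor_assoc, pr_leftUnitor, toC_id]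
      rw [act_toC]
      exact (id_tensorHom A (toC f)) ▸ rfl))
    (rightUnitor_naturality := fun {V W} f => tensorObj_ext (by
      simp only [toC_comp, pr_tensorHom_assoc, pr_rightUnitor_assoc, pr_rightUnitor, toC_id]
      exact (isSemilinear_toC f).ract.symm))
    (pentagon := fun U V W X => hom_ext' (pr_pr_ext
      ((cancel_epi (pr U V ▷ W.X ▷ X.X)).1 (by
        simp only [toC_comp, pr_tensorHom_assoc, toC_id, tensorHom_id]
        have h1 : pr U V ▷ W.X ▷ X.X ≫ pr (U ⊗ V) W ▷ X.X ≫ toC (α_ U V W).hom ▷ X.X =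
            (α_ U.X V.X W.X).hom ▷ X.X ≫ (U.X ◁ pr V W) ▷ X.X ≫ pr U (V ⊗ W) ▷ X.X := by
          simp only [← comp_whiskerRight, pr_associator]
        have h2 : U.X ◁ pr V W ▷ X.X ≫ U.X ◁ pr (V ⊗ W) X ≫ U.X ◁ toC (α_ V W X).hom =
            U.X ◁ (α_ V.X W.X X.X).hom ≫ U.X ◁ V.X ◁ pr W X ≫ U.X ◁ pr V (W ⊗ X) := by
          simp only [← whiskerLeft_comp, pr_associator]
        rw [reassoc_of% h1, pr_associator_assoc, pr_tensorHom, toC_id, id_tensorHom,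
          associator_naturality_middle_assoc, reassoc_of% h2, pr_associator_assoc,
          associator_naturality_left_assoc, ← whisker_exchange_assoc, pr_associator,
          associator_naturality_right_assoc]
        simp))))
    -- Both unitors are actions of the middle `A`, so the triangle is exactly the defining relation
    -- of `V ⊗_A W`.
    (triangle := fun V W => hom_ext' (pr_pr_ext (by
      simp only [toC_comp, pr_tensorHom, pr_associator_assoc, toC_id, id_tensorHom, tensorHom_id]
      rw [← whiskerLeft_comp_assoc, pr_leftUnitor, ← comp_whiskerRight_assoc, pr_rightUnitor]
      exact (ract_pr V W).symm)))

/-- Up to the right unitor of `C`, the map `V ⊗ 1 ⟶ V ⊗_A A` is the inverse unitor of `𝒟`, hence an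
isomorphism. This lets the triangle identities be tested on the unit of `A`. -/
theorem pr_one_ext_right {V Z : EquivMod π} {f g : V ⊗ 𝟙_ (EquivMod π) ⟶ Z}
    (h : V.X ◁ η[A] ≫ pr V (𝟙_ (EquivMod π)) ≫ toC f =
      V.X ◁ η[A] ≫ pr V (𝟙_ (EquivMod π)) ≫ toC g) : f = g := by
  have h1 : V.X ◁ η[A] ≫ pr V (𝟙_ (EquivMod π)) = (ρ_ V.X).hom ≫ toC (ρ_ V).inv := by
    have h2 : (V.X ◁ η[A] ≫ pr V (𝟙_ (EquivMod π))) ≫ toC (ρ_ V).hom = (ρ_ V.X).hom := by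
      rw [Category.assoc, pr_rightUnitor]; exact V.M.one_ract
    rw [← h2, Category.assoc, ← toC_comp, Iso.hom_inv_id, toC_id, Category.comp_id]
  rw [← Category.assoc, ← Category.assoc, h1, Category.assoc, Category.assoc, cancel_epi] at h
  exact (cancel_epi (ρ_ V).inv).1 (hom_ext' h)

theorem pr_one_ext_left {V Z : EquivMod π} {f g : 𝟙_ (EquivMod π) ⊗ V ⟶ Z}
    (h : η[A] ▷ V.X ≫ pr (𝟙_ (EquivMod π)) V ≫ toC f =
      η[A] ▷ V.X ≫ pr (𝟙_ (EquivMod π)) V ≫ toC g) : f = g := by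
  have h1 : η[A] ▷ V.X ≫ pr (𝟙_ (EquivMod π)) V = (λ_ V.X).hom ≫ toC (λ_ V).inv := by
    have h2 : (η[A] ▷ V.X ≫ pr (𝟙_ (EquivMod π)) V) ≫ toC (λ_ V).hom = (λ_ V.X).hom := by
      rw [Category.assoc, pr_leftUnitor]; exact V.M.one_act
    rw [← h2, Category.assoc, ← toC_comp, Iso.hom_inv_id, toC_id, Category.comp_id]
  rw [← Category.assoc, ← Category.assoc, h1, Category.assoc, Category.assoc, cancel_epi] at h
  exact (cancel_epi (λ_ V).inv).1 (hom_ext' h)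

theorem pr_associator_inv (U V W : EquivMod π) :
    U.X ◁ pr V W ≫ pr U (V ⊗ W) ≫ toC (α_ U V W).inv =
      (α_ U.X V.X W.X).inv ≫ pr U V ▷ W.X ≫ pr (U ⊗ V) W := by
  rw [Iso.eq_inv_comp, ← pr_associator_assoc, ← toC_comp, Iso.hom_inv_id, toC_id, Category.comp_id]

theorem pr_associator_inv_assoc (U V W : EquivMod π)
    {Z₀ : C} (k : _ ⟶ Z₀) :
    U.X ◁ pr V W ≫ pr U (V ⊗ W) ≫ toC (α_ U V W).inv ≫ k =
      (α_ U.X V.X W.X).inv ≫ pr U V ▷ W.X ≫ pr (U ⊗ V) W ≫ k :=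
  (reassoc_of% (pr_associator_inv U V W)) k

/-- The unit object of `𝒟` is `(A, π)`. -/
def unitIso : 𝟙_ (EquivMod π) ≅ algObj π := Iso.refl (algObj π)

theorem isNaturalTensor_pr : IsNaturalTensor (π := π) pr unitIso where
  tensor _ _ := isRelTensor_relProj
  action := pr_ρ
  hom := pr_tensorHom
  associator := pr_associator
  leftUnitor V := by
    rw [pr_leftUnitor]
    exact (congrArg (fun x => x ▷ V.X ≫ V.M.act) (Category.comp_id η[A])).trans V.M.one_act
  rightUnitor V := by
    rw [pr_rightUnitor]
    exact (congrArg (fun x => V.X ◁ x ≫ V.M.ract) (Category.comp_id η[A])).trans V.M.one_ract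

end EquivMod

/-! ### Abelian categories through a forgetful functor. -/

section AbelianForget

variable {E : Type*} [Category E] [Preadditive E] {C : Type*} [Category C] [Abelian C]

/-- A preadditive category with finite products and a faithful additive functor to an abelian
category which reflects isomorphisms and creates kernels and cokernels is abelian. -/
theorem exists_abelian_of_forget [HasFiniteProducts E] (F : E ⥤ C) [F.Additive] [F.Faithful]
    [F.ReflectsIsomorphisms]
    (hk : ∀ {X Y : E} (f : X ⟶ Y), ∃ (K : E) (k : K ⟶ X) (w : F.map k ≫ F.map f = 0),
      Nonempty (IsLimit (KernelFork.ofι (F.map k) w)) ∧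
        ∀ (Z : E) (g : Z ⟶ X), g ≫ f = 0 → ∃ l : Z ⟶ K, l ≫ k = g)
    (hc : ∀ {X Y : E} (f : X ⟶ Y), ∃ (Q : E) (q : Y ⟶ Q) (w : F.map f ≫ F.map q = 0),
      Nonempty (IsColimit (CokernelCofork.ofπ (F.map q) w)) ∧
        ∀ (Z : E) (g : Y ⟶ Z), f ≫ g = 0 → ∃ l : Q ⟶ Z, q ≫ l = g) :
    ∃ ab : Abelian E, ab.toPreadditive = ‹Preadditive E› := by
  have hk' : ∀ {X Y : E} (f : X ⟶ Y), ∃ c : KernelFork f, Nonempty (IsLimit c) ∧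
      Nonempty (IsLimit (F.mapCone c)) := by
    intro X Y f
    obtain ⟨K, k, w, ⟨hl⟩, h⟩ := hk f
    have w' : k ≫ f = 0 := F.map_injective (by rw [F.map_comp, w, F.map_zero])
    have : Mono (F.map k) := mono_of_isLimit_fork hl
    -- Only existence of lifts is assumed; uniqueness comes from `k` being mono, which the faithful
    -- `F` reflects.
    have : Mono k := F.mono_of_mono_map this
    choose l hl' using h
    exact ⟨KernelFork.ofι k w', ⟨KernelFork.IsLimit.ofι' k w' fun {Z} g hg =>
      ⟨l Z g hg, hl' Z g hg⟩⟩,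
      ⟨(KernelFork.isLimitMapConeEquiv _ F).symm hl⟩⟩
  have hc' : ∀ {X Y : E} (f : X ⟶ Y), ∃ c : CokernelCofork f, Nonempty (IsColimit c) ∧
      Nonempty (IsColimit (F.mapCocone c)) := by
    intro X Y f
    obtain ⟨Q, q, w, ⟨hl⟩, h⟩ := hc f
    have w' : f ≫ q = 0 := F.map_injective (by rw [F.map_comp, w, F.map_zero])
    have : Epi (F.map q) := epi_of_isColimit_cofork hl
    have : Epi q := F.epi_of_epi_map this
    choose l hl' using h
    exact ⟨CokernelCofork.ofπ q w',
      ⟨CokernelCofork.IsColimit.ofπ' q w' fun {Z} g hg => ⟨l Z g hg, hl' Z g hg⟩⟩,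
      ⟨(CokernelCofork.isColimitMapCoconeEquiv _ F).symm hl⟩⟩
  have : HasKernels E := ⟨fun f => by obtain ⟨c, ⟨h⟩, -⟩ := hk' f; exact ⟨⟨⟨c, h⟩⟩⟩⟩
  have : HasCokernels E := ⟨fun f => by obtain ⟨c, ⟨h⟩, -⟩ := hc' f; exact ⟨⟨⟨c, h⟩⟩⟩⟩
  have pl : ∀ {X Y : E} (f : X ⟶ Y), PreservesLimit (parallelPair f 0) F := fun f => by
    obtain ⟨c, ⟨h⟩, ⟨h'⟩⟩ := hk' f; exact preservesLimit_of_preserves_limit_cone h h'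
  have pc : ∀ {X Y : E} (f : X ⟶ Y), PreservesColimit (parallelPair f 0) F := fun f => by
    obtain ⟨c, ⟨h⟩, ⟨h'⟩⟩ := hc' f; exact preservesColimit_of_preserves_colimit_cocone h h'
  have : ∀ {X Y : E} (f : X ⟶ Y), IsIso (Abelian.coimageImageComparison f) := by
    intro X Y f
    -- Preserving kernels and cokernels, `F` carries the comparison map of `f` to that of `F.map f`,
    -- which is invertible because `C` is abelian.
    have : IsIso (F.map (Abelian.coimageImageComparison f)) := by
      rw [Arrow.isIso_iff_isIso_of_isIso (Abelian.PreservesCoimageImageComparison.iso F f).hom]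
      infer_instance
    exact isIso_of_reflects_iso _ F
  exact ⟨Abelian.ofCoimageImageComparisonIsIso, rfl⟩

/-- A preadditive category with a zero object and binary biproducts has finite products. -/
theorem hasFiniteProducts_of_biproducts (h0 : HasZeroObject E)
    (h : ∀ X Y : E, ∃ b : BinaryBicone X Y, b.fst ≫ b.inl + b.snd ≫ b.inr = 𝟙 b.pt) :
    HasFiniteProducts E := by
  have : HasBinaryBiproducts E := ⟨fun X Y => by
    obtain ⟨b, hb⟩ := h X Y
    exact hasBinaryBiproduct_of_total b hb⟩
  have : HasTerminal E := HasZeroObject.hasTerminal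
  exact hasFiniteProducts_of_has_binary_and_terminal

end AbelianForget

/-! ### Zero object, biproducts, kernels and cokernels in `𝒟` and `𝒟⁰`. -/

namespace EquivMod

variable {C : Type u} [Category.{v} C] [MonoidalCategory C] {G : Type w} [Group G] {A : C}
  [MonObj A] {π : AlgAction G A}

/-- A subobject of `V` in `C` stable under `A` and `G` is an object of `𝒟`. -/
abbrev ofMono (V : EquivMod π) {K : C} (k : K ⟶ V.X) [Mono k] (m : A ⊗ K ⟶ K)
    (hm : m ≫ k = A ◁ k ≫ V.M.act) (r : G → (K ⟶ K)) (hr : ∀ g, r g ≫ k = k ≫ V.ρ g) :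
    EquivMod π where
  M :=
    { X := K
      mod :=
        { smul := m
          one_smul := by
            change η[A] ▷ K ≫ m = (λ_ K).hom
            rw [← cancel_mono k, Category.assoc, hm, ← whisker_exchange_assoc, Mod.one_act,
              leftUnitor_naturality]
          mul_smul := by
            change μ[A] ▷ K ≫ m = (α_ A A K).hom ≫ A ◁ m ≫ m
            rw [← cancel_mono k, Category.assoc, hm, ← whisker_exchange_assoc, Mod.mul_act,
              associator_naturality_right_assoc, Category.assoc, Category.assoc, hm,
              ← whiskerLeft_comp_assoc, ← whiskerLeft_comp_assoc, hm] } }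
  φ :=
    { toFun := r
      map_one' := by
        change r 1 = 𝟙 K
        rw [← cancel_mono k, hr, ρ_one, Category.comp_id, Category.id_comp]
      map_mul' := fun g h => by
        change r (g * h) = r h ≫ r g
        rw [← cancel_mono k, hr, ρ_mul, Category.assoc, hr, reassoc_of% hr] }
  compat g := by
    change m ≫ r g = ((π.π g : A ⟶ A) ⊗ₘ r g) ≫ m
    have h := V.compat g
    rw [← cancel_mono k, Category.assoc, Category.assoc, hr, reassoc_of% hm, h, hm,
      tensorHom_comp_whiskerLeft_assoc, hr, whiskerLeft_comp_tensorHom_assoc]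

/-- A quotient of `V` in `C` by a subobject stable under `A` and `G` is an object of `𝒟`. -/
abbrev ofEpi [LeftRigidCategory C] (V : EquivMod π) {Q : C} (q : V.X ⟶ Q) [Epi q] (m : A ⊗ Q ⟶ Q)
    (hm : A ◁ q ≫ m = V.M.act ≫ q) (r : G → (Q ⟶ Q)) (hr : ∀ g, q ≫ r g = V.ρ g ≫ q) :
    EquivMod π where
  M :=
    { X := Q
      mod :=
        { smul := m
          one_smul := by
            change η[A] ▷ Q ≫ m = (λ_ Q).hom
            rw [← cancel_epi (𝟙_ C ◁ q), whisker_exchange_assoc, hm, Mod.one_act_assoc,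
              leftUnitor_naturality]
          mul_smul := by
            change μ[A] ▷ Q ≫ m = (α_ A A Q).hom ≫ A ◁ m ≫ m
            rw [← cancel_epi ((A ⊗ A) ◁ q), whisker_exchange_assoc, hm, Mod.mul_act_assoc,
              associator_naturality_right_assoc, ← whiskerLeft_comp_assoc, hm,
              whiskerLeft_comp_assoc, hm] } }
  φ :=
    { toFun := r
      map_one' := by
        change r 1 = 𝟙 Q
        rw [← cancel_epi q, hr, ρ_one, Category.comp_id, Category.id_comp]
      map_mul' := fun g h => by
        change r (g * h) = r h ≫ r g
        rw [← cancel_epi q, hr, ρ_mul, Category.assoc, reassoc_of% hr, hr] }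
  compat g := by
    change m ≫ r g = ((π.π g : A ⟶ A) ⊗ₘ r g) ≫ m
    have h := V.compat g
    rw [← cancel_epi (A ◁ q), reassoc_of% hm, hr, reassoc_of% h, whiskerLeft_comp_tensorHom_assoc,
      hr, ← tensorHom_comp_whiskerLeft_assoc, hm]

section Local

variable [BraidedCategory C]

/-- Locality is an equation natural along module maps, so it restricts to subobjects and, since `A ⊗
-` preserves epimorphisms, passes to quotients. This gives `𝒟⁰` its kernels and cokernels. -/
theorem isLocal_of_mono {V W : EquivMod π} (f : V ⟶ W) [Mono (toC f)] (h : W.M.IsLocal) :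
    V.M.IsLocal := by
  unfold Mod.IsLocal at *
  rw [← cancel_mono (toC f)]
  simp only [Category.assoc]
  rw [act_toC, ← BraidedCategory.braiding_naturality_left_assoc,
    ← BraidedCategory.braiding_naturality_right_assoc, h]

theorem isLocal_of_epi [LeftRigidCategory C] {V W : EquivMod π} (f : V ⟶ W) [Epi (toC f)]
    (h : V.M.IsLocal) : W.M.IsLocal := by
  unfold Mod.IsLocal at *
  rw [← cancel_epi (A ◁ toC f), BraidedCategory.braiding_naturality_right_assoc,
    BraidedCategory.braiding_naturality_left_assoc, ← act_toC, reassoc_of% h]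

end Local

variable [Abelian C] [Linear ℂ C] [MonoidalPreadditive C] [MonoidalLinear ℂ C]

@[simp] theorem toC_zero (V W : EquivMod π) : toC (0 : V ⟶ W) = 0 := rfl
@[simp] theorem toC_add {V W : EquivMod π} (f g : V ⟶ W) : toC (f + g) = toC f + toC g := rfl
@[simp] theorem toC_smul {V W : EquivMod π} (c : ℂ) (f : V ⟶ W) : toC (c • f) = c • toC f := rfl

variable (π) in
/-- The forgetful functor from `𝒟` to `C`. -/
@[simps]
def forgetC : EquivMod π ⥤ C where
  obj V := V.X
  map f := toC f

instance : (forgetC π).Faithful := ⟨fun h => hom_ext' h⟩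
instance : (forgetC π).Additive where

open ZeroObject in
/-- The zero object of `𝒟`. -/
noncomputable def zeroObj (π : AlgAction G A) : EquivMod π where
  M :=
    { X := 0
      mod :=
        { smul := 0
          one_smul := (isZero_zero C).eq_of_tgt _ _
          mul_smul := (isZero_zero C).eq_of_tgt _ _ } }
  φ :=
    { toFun := fun _ => 𝟙 (0 : C)
      map_one' := rfl
      map_mul' := fun _ _ => (Category.comp_id _).symm }
  compat _ := (isZero_zero C).eq_of_tgt _ _

theorem isZero_zeroObj : IsZero (zeroObj π) :=
  (IsZero.iff_id_eq_zero _).2 (hom_ext' ((isZero_zero C).eq_of_tgt _ _))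

/-- The biproduct in `𝒟`. -/
noncomputable abbrev biprodObj (V W : EquivMod π) : EquivMod π where
  M :=
    { X := V.X ⊞ W.X
      mod :=
        { smul := biprod.lift (A ◁ biprod.fst ≫ V.M.act) (A ◁ biprod.snd ≫ W.M.act)
          one_smul := by
            change η[A] ▷ _ ≫ _ = (λ_ _).hom
            apply biprod.hom_ext
            · rw [Category.assoc, biprod.lift_fst, ← whisker_exchange_assoc, Mod.one_act,
                leftUnitor_naturality]
            · rw [Category.assoc, biprod.lift_snd, ← whisker_exchange_assoc, Mod.one_act,
                leftUnitor_naturality]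
          mul_smul := by
            change μ[A] ▷ _ ≫ _ = (α_ A A _).hom ≫ A ◁ _ ≫ _
            apply biprod.hom_ext
            · simp only [Category.assoc, biprod.lift_fst]
              rw [← whisker_exchange_assoc, Mod.mul_act, ← whiskerLeft_comp_assoc, biprod.lift_fst]
              simp
            · simp only [Category.assoc, biprod.lift_snd]
              rw [← whisker_exchange_assoc, Mod.mul_act, ← whiskerLeft_comp_assoc, biprod.lift_snd]
              simp } }
  φ :=
    { toFun := fun g => biprod.map (V.ρ g) (W.ρ g)
      map_one' := by
        change _ = 𝟙 (V.X ⊞ W.X)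
        rw [ρ_one, ρ_one]; ext <;> simp
      map_mul' := fun g h => by
        change _ = biprod.map _ _ ≫ biprod.map _ _
        rw [ρ_mul, ρ_mul]; ext <;> simp }
  compat g := by
    change biprod.lift _ _ ≫ biprod.map _ _ =
      ((π.π g : A ⟶ A) ⊗ₘ biprod.map _ _) ≫ biprod.lift _ _
    have h1 := V.compat g
    have h2 := W.compat g
    apply biprod.hom_ext
    · simp only [Category.assoc, biprod.map_fst, biprod.lift_fst, biprod.lift_fst_assoc]
      rw [h1, tensorHom_comp_whiskerLeft_assoc, biprod.map_fst, whiskerLeft_comp_tensorHom_assoc]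
    · simp only [Category.assoc, biprod.map_snd, biprod.lift_snd, biprod.lift_snd_assoc]
      rw [h2, tensorHom_comp_whiskerLeft_assoc, biprod.map_snd, whiskerLeft_comp_tensorHom_assoc]

end EquivMod

namespace EquivMod

variable {C : Type u} [Category.{v} C] [MonoidalCategory C] {G : Type w} [Group G] {A : C}
  [MonObj A] {π : AlgAction G A}
  [Abelian C] [Linear ℂ C] [MonoidalPreadditive C] [MonoidalLinear ℂ C]

/-- The binary biproduct bicone in `𝒟`. -/
noncomputable def biprodBicone (V W : EquivMod π) : BinaryBicone V W where
  pt := biprodObj V W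
  fst := mkHom (W := V) biprod.fst (isSemilinear_id_iff.2 (biprod.lift_fst _ _))
    (fun _ => biprod.map_fst _ _)
  snd := mkHom (W := W) biprod.snd (isSemilinear_id_iff.2 (biprod.lift_snd _ _))
    (fun _ => biprod.map_snd _ _)
  inl := mkHom (V := V) biprod.inl (isSemilinear_id_iff.2 (by
      change _ = A ◁ biprod.inl ≫ biprod.lift _ _
      apply biprod.hom_ext <;> simp [← whiskerLeft_comp_assoc]))
    (fun _ => (biprod.inl_map _ _).symm)
  inr := mkHom (V := W) biprod.inr (isSemilinear_id_iff.2 (by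
      change _ = A ◁ biprod.inr ≫ biprod.lift _ _
      apply biprod.hom_ext <;> simp [← whiskerLeft_comp_assoc]))
    (fun _ => (biprod.inr_map _ _).symm)
  inl_fst := hom_ext' biprod.inl_fst
  inl_snd := hom_ext' biprod.inl_snd
  inr_fst := hom_ext' biprod.inr_fst
  inr_snd := hom_ext' biprod.inr_snd

theorem biprodBicone_total (V W : EquivMod π) : (biprodBicone V W).fst ≫ (biprodBicone V W).inl +
    (biprodBicone V W).snd ≫ (biprodBicone V W).inr = 𝟙 (biprodBicone V W).pt :=
  hom_ext' biprod.total

/-- The kernel of a morphism of `𝒟`. -/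
noncomputable abbrev kernelObj {V W : EquivMod π} (f : V ⟶ W) : EquivMod π :=
  ofMono V (kernel.ι (toC f))
    (kernel.lift (toC f) (A ◁ kernel.ι (toC f) ≫ V.M.act) (by
      rw [Category.assoc, act_toC, ← whiskerLeft_comp_assoc, kernel.condition,
        MonoidalPreadditive.whiskerLeft_zero, zero_comp]))
    (kernel.lift_ι _ _ _)
    (fun g => kernel.lift (toC f) (kernel.ι (toC f) ≫ V.ρ g) (by
      rw [Category.assoc, ρ_toC, kernel.condition_assoc, zero_comp]))
    (fun _ => kernel.lift_ι _ _ _)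

noncomputable def kernelι {V W : EquivMod π} (f : V ⟶ W) : kernelObj f ⟶ V :=
  mkHom (V := kernelObj f) (kernel.ι (toC f)) (isSemilinear_id_iff.2 (kernel.lift_ι _ _ _))
    (fun _ => kernel.lift_ι _ _ _)

theorem exists_kernel_lift {V W Z : EquivMod π} (f : V ⟶ W) (g : Z ⟶ V) (h : g ≫ f = 0) :
    ∃ l : Z ⟶ kernelObj f, l ≫ kernelι f = g := by
  have h' : toC g ≫ toC f = 0 := congrArg toC h
  let k : (kernelObj f).X ⟶ V.X := kernel.ι (toC f)
  have : Mono k := inferInstanceAs (Mono (kernel.ι (toC f)))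
  have hm : (kernelObj f).M.act ≫ k = A ◁ k ≫ V.M.act := kernel.lift_ι _ _ _
  have hr : ∀ x, (kernelObj f).ρ x ≫ k = k ≫ V.ρ x := fun x => kernel.lift_ι _ _ _
  let l : Z.X ⟶ (kernelObj f).X := kernel.lift (toC f) (toC g) h'
  have hl : l ≫ k = toC g := kernel.lift_ι _ _ _
  refine ⟨mkHom l (isSemilinear_id_iff.2 ?_) (fun x => ?_), hom_ext' hl⟩
  · rw [← cancel_mono k, Category.assoc, Category.assoc, hl, hm, act_toC,
      ← whiskerLeft_comp_assoc, hl]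
  · rw [← cancel_mono k, Category.assoc, Category.assoc, hl, hr, reassoc_of% hl, ρ_toC]

section Cokernel

variable [LeftRigidCategory C]

theorem exists_cokernel_act {V W : EquivMod π} (f : V ⟶ W) :
    ∃ m : A ⊗ cokernel (toC f) ⟶ cokernel (toC f),
      A ◁ cokernel.π (toC f) ≫ m = W.M.act ≫ cokernel.π (toC f) := by
  refine exists_whiskerLeft_desc (w := by simp) (cokernelIsCokernel (toC f)) A _ ?_
  rw [← act_toC_assoc, cokernel.condition, comp_zero, MonoidalPreadditive.whiskerLeft_zero,
    zero_comp]

/-- The cokernel of a morphism of `𝒟`. -/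
noncomputable abbrev cokernelObj {V W : EquivMod π} (f : V ⟶ W) : EquivMod π :=
  ofEpi W (cokernel.π (toC f)) (exists_cokernel_act f).choose (exists_cokernel_act f).choose_spec
    (fun g => cokernel.desc (toC f) (W.ρ g ≫ cokernel.π (toC f)) (by
      rw [← ρ_toC_assoc, cokernel.condition, comp_zero]))
    (fun _ => cokernel.π_desc _ _ _)

noncomputable def cokernelπ {V W : EquivMod π} (f : V ⟶ W) : W ⟶ cokernelObj f :=
  mkHom (W := cokernelObj f) (cokernel.π (toC f))
    (isSemilinear_id_iff.2 (exists_cokernel_act f).choose_spec.symm)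
    (fun _ => (cokernel.π_desc _ _ _).symm)

theorem exists_cokernel_desc {V W Z : EquivMod π} (f : V ⟶ W) (g : W ⟶ Z) (h : f ≫ g = 0) :
    ∃ l : cokernelObj f ⟶ Z, cokernelπ f ≫ l = g := by
  have h' : toC f ≫ toC g = 0 := congrArg toC h
  let q : W.X ⟶ (cokernelObj f).X := cokernel.π (toC f)
  have : Epi q := inferInstanceAs (Epi (cokernel.π (toC f)))
  have hm : A ◁ q ≫ (cokernelObj f).M.act = W.M.act ≫ q := (exists_cokernel_act f).choose_spec
  have hr : ∀ x, q ≫ (cokernelObj f).ρ x = W.ρ x ≫ q := fun x => cokernel.π_desc _ _ _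
  let l : (cokernelObj f).X ⟶ Z.X := cokernel.desc (toC f) (toC g) h'
  have hl : q ≫ l = toC g := cokernel.π_desc _ _ _
  refine ⟨mkHom l (isSemilinear_id_iff.2 ?_) (fun x => ?_), hom_ext' hl⟩
  · rw [← cancel_epi (A ◁ q), reassoc_of% hm, hl, ← whiskerLeft_comp_assoc, hl, act_toC]
  · rw [← cancel_epi q, reassoc_of% hr, hl, reassoc_of% hl, ρ_toC]

end Cokernel

instance : (forgetC π).ReflectsIsomorphisms where
  reflects {V W} f hf := by
    have : IsIso (toC f) := hf
    exact (isoOfInv f (inv (toC f)) (IsIso.hom_inv_id _) (IsIso.inv_hom_id _)).isIso_hom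

variable (π) in
/-- `𝒟` is abelian. -/
theorem exists_abelian [LeftRigidCategory C] :
    ∃ ab : Abelian (EquivMod π), 
      ab.toPreadditive = (inferInstance : Preadditive _) := by
  have : HasFiniteProducts (EquivMod π) := hasFiniteProducts_of_biproducts
    ⟨⟨zeroObj π, isZero_zeroObj⟩⟩ (fun V W => ⟨biprodBicone V W, biprodBicone_total V W⟩)
  exact exists_abelian_of_forget (forgetC π)
    (fun f => ⟨kernelObj f, kernelι f, kernel.condition (toC f), ⟨kernelIsKernel (toC f)⟩,
      fun _ g hg => exists_kernel_lift f g hg⟩)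
    (fun f => ⟨cokernelObj f, cokernelπ f, cokernel.condition (toC f),
      ⟨cokernelIsCokernel (toC f)⟩, fun _ g hg => exists_cokernel_desc f g hg⟩)

section FullSubcategory

variable [LeftRigidCategory C] (P : ObjectProperty (EquivMod π))

/-- A full subcategory of `𝒟` closed under zero, biproducts, kernels and cokernels is abelian. -/
theorem exists_abelian_fullSubcategory (h0 : P (zeroObj π))
    (h2 : ∀ V W, P V → P W → P (biprodObj V W))
    (hk : ∀ {V W : EquivMod π} (f : V ⟶ W), P V → P (kernelObj f))
    (hc : ∀ {V W : EquivMod π} (f : V ⟶ W), P W → P (cokernelObj f)) :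
    ∃ ab : Abelian P.FullSubcategory,
      ab.toPreadditive = (inferInstance : Preadditive _) := by
  have : HasFiniteProducts P.FullSubcategory := by
    refine hasFiniteProducts_of_biproducts ⟨⟨⟨zeroObj π, h0⟩, ?_⟩⟩ (fun V W => ?_)
    · exact (IsZero.iff_id_eq_zero _).2 (ObjectProperty.hom_ext _
        ((IsZero.iff_id_eq_zero _).1 isZero_zeroObj))
    · let b := biprodBicone V.obj W.obj
      exact ⟨{
          pt := ⟨biprodObj V.obj W.obj, h2 _ _ V.property W.property⟩
          fst := ObjectProperty.homMk b.fst
          snd := ObjectProperty.homMk b.snd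
          inl := ObjectProperty.homMk b.inl
          inr := ObjectProperty.homMk b.inr
          inl_fst := ObjectProperty.hom_ext _ b.inl_fst
          inl_snd := ObjectProperty.hom_ext _ b.inl_snd
          inr_fst := ObjectProperty.hom_ext _ b.inr_fst
          inr_snd := ObjectProperty.hom_ext _ b.inr_snd },
        ObjectProperty.hom_ext _ (biprodBicone_total V.obj W.obj)⟩
  have : P.ι.ReflectsIsomorphisms := reflectsIsomorphisms_of_full_and_faithful P.ι
  have : (P.ι ⋙ forgetC π).ReflectsIsomorphisms := reflectsIsomorphisms_comp P.ι (forgetC π)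
  refine exists_abelian_of_forget (P.ι ⋙ forgetC π) (fun {V W} f => ?_) (fun {V W} f => ?_)
  · refine ⟨⟨kernelObj f.hom, hk f.hom V.property⟩, ObjectProperty.homMk (kernelι f.hom),
      kernel.condition (toC f.hom), ⟨kernelIsKernel (toC f.hom)⟩, fun Z g hg => ?_⟩
    obtain ⟨l, hl⟩ := exists_kernel_lift f.hom g.hom (congrArg (fun x => x.hom) hg)
    exact ⟨ObjectProperty.homMk l, ObjectProperty.hom_ext _ hl⟩
  · refine ⟨⟨cokernelObj f.hom, hc f.hom W.property⟩, ObjectProperty.homMk (cokernelπ f.hom),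
      cokernel.condition (toC f.hom), ⟨cokernelIsCokernel (toC f.hom)⟩, fun Z g hg => ?_⟩
    obtain ⟨l, hl⟩ := exists_cokernel_desc f.hom g.hom (congrArg (fun x => x.hom) hg)
    exact ⟨ObjectProperty.homMk l, ObjectProperty.hom_ext _ hl⟩

end FullSubcategory

section Local

variable [BraidedCategory C]

theorem isLocal_biprodObj {V W : EquivMod π} (hV : V.M.IsLocal) (hW : W.M.IsLocal) :
    (biprodObj V W).M.IsLocal := by
  have h1 := act_toC (biprodBicone V W).fst
  have h2 := act_toC (biprodBicone V W).snd
  change (biprodObj V W).M.act ≫ biprod.fst = A ◁ biprod.fst ≫ _ at h1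
  change (biprodObj V W).M.act ≫ biprod.snd = A ◁ biprod.snd ≫ _ at h2
  unfold Mod.IsLocal at *
  apply biprod.hom_ext
  · simp only [Category.assoc]
    rw [h1, ← BraidedCategory.braiding_naturality_left_assoc]
    refine (BraidedCategory.braiding_naturality_right_assoc A biprod.fst _).symm.trans ?_
    rw [hV]
  · simp only [Category.assoc]
    rw [h2, ← BraidedCategory.braiding_naturality_left_assoc]
    refine (BraidedCategory.braiding_naturality_right_assoc A biprod.snd _).symm.trans ?_
    rw [hW]

theorem isLocal_zeroObj : (zeroObj π).M.IsLocal :=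
  (isZero_zero C).eq_of_tgt _ _

variable (π) in
/-- `𝒟⁰` is abelian. -/
theorem exists_abelian_isLocal [LeftRigidCategory C] :
    ∃ ab : Abelian (isLocal π).FullSubcategory,
      ab.toPreadditive = (inferInstance : Preadditive _) :=
  exists_abelian_fullSubcategory (isLocal π) isLocal_zeroObj
    (fun _ _ => isLocal_biprodObj)
    (fun f h =>
      have : Mono (toC (kernelι f)) := inferInstanceAs (Mono (kernel.ι (toC f)))
      isLocal_of_mono (kernelι f) h)
    (fun f h =>
      have : Epi (toC (cokernelπ f)) := inferInstanceAs (Epi (cokernel.π (toC f)))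
      isLocal_of_epi (cokernelπ f) h)

end Local

end EquivMod

/-! ### Linearity, finiteness and the endomorphisms of the unit. -/

namespace EquivMod

variable {C : Type u} [Category.{v} C] [MonoidalCategory C] {G : Type w} [Group G] {A : C}
  [MonObj A] {π : AlgAction G A} [Abelian C] [Linear ℂ C] [MonoidalPreadditive C]
  [MonoidalLinear ℂ C]

/-- The inclusion of the morphisms of `𝒟` into those of `C`. -/
def toCLinear (V W : EquivMod π) : (V ⟶ W) →ₗ[ℂ] (V.X ⟶ W.X) where
  toFun := toC
  map_add' _ _ := rfl
  map_smul' _ _ := rfl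

theorem finiteDimensional_hom (h : ∀ X Y : C, FiniteDimensional ℂ (X ⟶ Y)) (V W : EquivMod π) :
    FiniteDimensional ℂ (V ⟶ W) :=
  have := h V.X W.X
  FiniteDimensional.of_injective (toCLinear V W) (fun _ _ h => hom_ext' h)

variable [BraidedCategory C] [IsCommMonObj A] [RigidCategory C]

instance : MonoidalPreadditive (EquivMod π) where
  whiskerLeft_zero := tensorObj_ext (by simp)
  zero_whiskerRight := tensorObj_ext (by simp)
  whiskerLeft_add _ _ := tensorObj_ext (by simp [Preadditive.comp_add])
  add_whiskerRight _ _ := tensorObj_ext (by simp [Preadditive.comp_add])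

instance : MonoidalLinear ℂ (EquivMod π) where
  whiskerLeft_smul _ _ _ _ _ := tensorObj_ext (by simp)
  smul_whiskerRight _ _ _ _ _ := tensorObj_ext (by simp)

/-- An `A`-linear endomorphism of `A` is multiplication by its value on the unit, so these
endomorphisms embed in the line `Hom(1, A)`; the identity is nonzero, since otherwise that line
would vanish. -/
theorem finrank_end_unit (h : Module.finrank ℂ (𝟙_ C ⟶ A) = 1) :
    Module.finrank ℂ (𝟙_ (EquivMod π) ⟶ 𝟙_ (EquivMod π)) = 1 := by
  have : Module.Finite ℂ (𝟙_ C ⟶ A) := Module.finite_of_finrank_eq_succ h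
  let F : (𝟙_ (EquivMod π) ⟶ 𝟙_ (EquivMod π)) →ₗ[ℂ] (𝟙_ C ⟶ A) :=
    (Linear.leftComp ℂ A η[A]).comp (toCLinear (𝟙_ (EquivMod π)) (𝟙_ (EquivMod π)))
  have hF : Function.Injective F := by
    have key : ∀ f : 𝟙_ (EquivMod π) ⟶ 𝟙_ (EquivMod π),
        (toC f : A ⟶ A) = (ρ_ A).inv ≫ A ◁ (F f) ≫ μ[A] := by
      intro f
      have h1 : μ[A] ≫ (toC f : A ⟶ A) = A ◁ (toC f : A ⟶ A) ≫ μ[A] := act_toC f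
      change _ = (ρ_ A).inv ≫ A ◁ (η[A] ≫ (toC f : A ⟶ A)) ≫ μ[A]
      rw [whiskerLeft_comp_assoc, ← h1, MonObj.mul_one_assoc, Iso.inv_hom_id_assoc]
    intro f g hfg
    exact hom_ext' ((key f).trans (by rw [hfg]; exact (key g).symm))
  have : Nontrivial (𝟙_ (EquivMod π) ⟶ 𝟙_ (EquivMod π)) := by
    refine ⟨𝟙 _, 0, fun h0 => ?_⟩
    have h1 : 𝟙 A = 0 := congrArg toC h0
    have h2 : ∀ f : 𝟙_ C ⟶ A, f = 0 := fun f => by rw [← Category.comp_id f, h1, comp_zero]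
    have : Subsingleton (𝟙_ C ⟶ A) := ⟨fun f g => (h2 f).trans (h2 g).symm⟩
    rw [Module.finrank_zero_of_subsingleton] at h
    exact zero_ne_one h
  have : Module.Finite ℂ (𝟙_ (EquivMod π) ⟶ 𝟙_ (EquivMod π)) := Module.Finite.of_injective F hF
  have h1 := LinearMap.finrank_le_finrank_of_injective hF
  have h2 : 0 < Module.finrank ℂ (𝟙_ (EquivMod π) ⟶ 𝟙_ (EquivMod π)) := Module.finrank_pos
  omega

variable (π) in
theorem isTensorCategory (hfin : ∀ X Y : C, FiniteDimensional ℂ (X ⟶ Y))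
    (h : Module.finrank ℂ (𝟙_ C ⟶ A) = 1) : IsTensorCategory (EquivMod π) where
  abelian := exists_abelian π
  bilinear := ⟨inferInstance, inferInstance⟩
  finiteDimensional := finiteDimensional_hom hfin
  unit := finrank_end_unit h

variable (π) in
theorem isTensorCategory_isLocal [(isLocal π).IsMonoidal]
    (hfin : ∀ X Y : C, FiniteDimensional ℂ (X ⟶ Y)) (h : Module.finrank ℂ (𝟙_ C ⟶ A) = 1) :
    IsTensorCategory (isLocal π).FullSubcategory where
  abelian := exists_abelian_isLocal π
  bilinear := ⟨inferInstance, inferInstance⟩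
  finiteDimensional V W :=
    have : FiniteDimensional ℂ ((isLocal π).ι.obj V ⟶ (isLocal π).ι.obj W) :=
      finiteDimensional_hom hfin V.obj W.obj
    FiniteDimensional.of_injective ((isLocal π).ι.mapLinearMap ℂ (X := V) (Y := W))
      (isLocal π).ι.map_injective
  unit := (LinearEquiv.ofBijective ((isLocal π).ι.mapLinearMap ℂ
    (X := 𝟙_ (isLocal π).FullSubcategory) (Y := 𝟙_ (isLocal π).FullSubcategory))
      ⟨(isLocal π).ι.map_injective, (isLocal π).ι.map_surjective⟩).finrank_eq.trans
        (finrank_end_unit h)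

end EquivMod

/-! ### Exact pairings in a monoidal category. -/

section Pairing

variable {C : Type u} [Category.{v} C] [MonoidalCategory C]

open ExactPairing

/-- The morphism `X ⟶ Y` corresponding to a pairing `Y' ⊗ X ⟶ 1`, for `Y'` right dual to `Y`. -/
def curryLeft (Y Y' : C) [ExactPairing Y Y'] {X : C} (f : Y' ⊗ X ⟶ 𝟙_ C) : X ⟶ Y :=
  tensorLeftHomEquiv X Y Y' (𝟙_ C) f ≫ (ρ_ Y).hom

/-- The morphism `X ⟶ Y'` corresponding to a pairing `X ⊗ Y ⟶ 1`, for `Y'` right dual to `Y`. -/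
def curryRight (Y Y' : C) [ExactPairing Y Y'] {X : C} (f : X ⊗ Y ⟶ 𝟙_ C) : X ⟶ Y' :=
  tensorRightHomEquiv X Y Y' (𝟙_ C) f ≫ (λ_ Y').hom

/-- Nondegeneracy in its working form: a morphism into `Y` can be prescribed, and tested, through
its pairing with `Y'`. -/
theorem eq_curryLeft_iff {Y Y' : C} [ExactPairing Y Y'] {X : C} {f : Y' ⊗ X ⟶ 𝟙_ C} {g : X ⟶ Y} :
    g = curryLeft Y Y' f ↔ Y' ◁ g ≫ ε_ Y Y' = f := by
  rw [curryLeft, ← Iso.comp_inv_eq, ← Equiv.symm_apply_eq]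
  have : (tensorLeftHomEquiv X Y Y' (𝟙_ C)).symm (g ≫ (ρ_ Y).inv) = Y' ◁ g ≫ ε_ Y Y' := by
    change Y' ◁ (g ≫ (ρ_ Y).inv) ≫ (α_ _ _ _).inv ≫ ε_ Y Y' ▷ 𝟙_ C ≫ (λ_ _).hom = _
    monoidal
  rw [this]

theorem eq_curryRight_iff {Y Y' : C} [ExactPairing Y Y'] {X : C} {f : X ⊗ Y ⟶ 𝟙_ C}
    {g : X ⟶ Y'} : g = curryRight Y Y' f ↔ g ▷ Y ≫ ε_ Y Y' = f := by
  rw [curryRight, ← Iso.comp_inv_eq, ← Equiv.symm_apply_eq]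
  have : (tensorRightHomEquiv X Y Y' (𝟙_ C)).symm (g ≫ (λ_ Y').inv) = g ▷ Y ≫ ε_ Y Y' := by
    change (g ≫ (λ_ Y').inv) ▷ Y ≫ (α_ _ _ _).hom ≫ 𝟙_ C ◁ ε_ Y Y' ≫ (ρ_ _).hom = _
    monoidal
  rw [this]

theorem whiskerLeft_curryLeft {Y Y' : C} [ExactPairing Y Y'] {X : C} (f : Y' ⊗ X ⟶ 𝟙_ C) :
    Y' ◁ curryLeft Y Y' f ≫ ε_ Y Y' = f :=
  eq_curryLeft_iff.1 rfl

theorem whiskerRight_curryRight {Y Y' : C} [ExactPairing Y Y'] {X : C} (f : X ⊗ Y ⟶ 𝟙_ C) :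
    curryRight Y Y' f ▷ Y ≫ ε_ Y Y' = f :=
  eq_curryRight_iff.1 rfl

theorem ext_of_whiskerLeft {Y Y' : C} [ExactPairing Y Y'] {X : C} {g h : X ⟶ Y}
    (w : Y' ◁ g ≫ ε_ Y Y' = Y' ◁ h ≫ ε_ Y Y') : g = h :=
  (eq_curryLeft_iff.2 w).trans (eq_curryLeft_iff.2 rfl).symm

theorem ext_of_whiskerRight {Y Y' : C} [ExactPairing Y Y'] {X : C} {g h : X ⟶ Y'}
    (w : g ▷ Y ≫ ε_ Y Y' = h ▷ Y ≫ ε_ Y Y') : g = h :=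
  (eq_curryRight_iff.2 w).trans (eq_curryRight_iff.2 rfl).symm

theorem comp_curryLeft {Y Y' : C} [ExactPairing Y Y'] {X X' : C} (g : X' ⟶ X)
    (f : Y' ⊗ X ⟶ 𝟙_ C) : g ≫ curryLeft Y Y' f = curryLeft Y Y' (Y' ◁ g ≫ f) := by
  rw [eq_curryLeft_iff, whiskerLeft_comp_assoc, whiskerLeft_curryLeft]

theorem comp_curryRight {Y Y' : C} [ExactPairing Y Y'] {X X' : C} (g : X' ⟶ X)
    (f : X ⊗ Y ⟶ 𝟙_ C) : g ≫ curryRight Y Y' f = curryRight Y Y' (g ▷ Y ≫ f) := by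
  rw [eq_curryRight_iff, comp_whiskerRight_assoc, whiskerRight_curryRight]

/-- The trace-like composite `1 ⟶ X ⊗ Y ⟶ Y ⊗ X ⟶ 1` does not depend on the duality chosen. -/
theorem coevaluation_braiding_evaluation_eq [BraidedCategory C] {X Y Y' : C}
    (e : ExactPairing X Y) (e' : ExactPairing X Y') :
    η_ X Y ≫ (β_ X Y).hom ≫ ε_ X Y = η_ X Y' ≫ (β_ X Y').hom ≫ ε_ X Y' := by
  -- The canonical comparison of two right duals of `X`; it matches both coevaluations and
  -- evaluations, and naturality of the braiding slides it across.
  let i : Y ⟶ Y' := (ρ_ Y).inv ≫ (tensorLeftHomEquiv (𝟙_ C) X Y Y').symm (η_ X Y')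
  have h1 : η_ X Y ≫ X ◁ i = η_ X Y' := by
    apply (tensorLeftHomEquiv (𝟙_ C) X Y Y').symm.injective
    rw [tensorLeftHomEquiv_symm_coevaluation_comp_whiskerLeft]
    simp [i]
  have h2 : i ▷ X ≫ ε_ X Y' = ε_ X Y := by
    apply (tensorRightHomEquiv Y X Y' (𝟙_ C)).injective
    apply (tensorRightHomEquiv Y X Y' (𝟙_ C)).symm.injective
    rw [Equiv.symm_apply_apply]
    have h3 : tensorRightHomEquiv Y X Y' (𝟙_ C) (ε_ X Y) = i ≫ (λ_ Y').inv := by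
      simp [tensorRightHomEquiv, tensorLeftHomEquiv, i]
    rw [h3]
    change _ = (i ≫ (λ_ Y').inv) ▷ X ≫ (α_ _ _ _).hom ≫ 𝟙_ C ◁ ε_ X Y' ≫ (ρ_ _).hom
    monoidal
  rw [← h1, Category.assoc, BraidedCategory.braiding_naturality_right_assoc, h2]

/-- The coevaluation is invariant under a pair of automorphisms preserving the evaluation. -/
theorem coevaluation_tensorHom {X Y : C} [ExactPairing X Y] {f f' : X ⟶ X} {g g' : Y ⟶ Y}
    (hg : g' ≫ g = 𝟙 Y) (h : (g' ⊗ₘ f') ≫ ε_ X Y = ε_ X Y) (hf : f ≫ f' = 𝟙 X) :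
    η_ X Y ≫ (f ⊗ₘ g) = η_ X Y := by
  have h' : Y ◁ f ≫ ε_ X Y = g' ▷ X ≫ ε_ X Y := by
    conv_lhs => rw [← h, whiskerLeft_comp_tensorHom_assoc, hf, tensorHom_id]
  apply (tensorLeftHomEquiv (𝟙_ C) X Y Y).symm.injective
  have h2 : (tensorLeftHomEquiv (𝟙_ C) X Y Y).symm (η_ X Y) = (ρ_ Y).hom := by
    simpa using tensorLeftHomEquiv_symm_coevaluation_comp_whiskerLeft (𝟙 Y) (Y := X)
  rw [h2]
  change Y ◁ (η_ X Y ≫ (f ⊗ₘ g)) ≫ (α_ _ _ _).inv ≫ ε_ X Y ▷ Y ≫ (λ_ _).hom = _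
  -- Inside the snake, `f` slides through the evaluation and becomes `g'`; the snake straightens and
  -- `g'` cancels `g`.
  calc _ = Y ◁ η_ X Y ⊗≫ (Y ◁ f ≫ ε_ X Y) ▷ Y ⊗≫ g := by
        rw [MonoidalCategory.tensorHom_def]
        calc _ = Y ◁ η_ X Y ⊗≫ (Y ◁ f) ▷ Y ⊗≫ ((Y ⊗ X) ◁ g ≫ ε_ X Y ▷ Y) ⊗≫ 𝟙 _ := by monoidal
          _ = _ := by rw [whisker_exchange]; monoidal
    _ = (g' ▷ 𝟙_ C ≫ Y ◁ η_ X Y) ⊗≫ ε_ X Y ▷ Y ⊗≫ g := by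
        rw [h', ← whisker_exchange]; monoidal
    _ = g' ▷ 𝟙_ C ⊗≫ (Y ◁ η_ X Y ⊗≫ ε_ X Y ▷ Y) ⊗≫ g := by monoidal
    _ = 𝟙 _ ⊗≫ (g' ≫ g) := by rw [coevaluation_evaluation'']; monoidal
    _ = _ := by rw [hg]; monoidal

end Pairing

/-! ### The Frobenius form: linear maps into `A` against morphisms into `1`. -/

section Frobenius

variable {C : Type u} [Category.{v} C] [MonoidalCategory C] {A : C} [MonObj A] [ExactPairing A A]
  {ε : A ⟶ 𝟙_ C}

/-- The morphism `Z ⟶ A` of `A`-modules corresponding to `f : Z ⟶ 1`. -/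
def linExt (Z : Mod C A) (f : Z.X ⟶ 𝟙_ C) : Z.X ⟶ A := curryLeft A A (Z.act ≫ f)

theorem whiskerLeft_linExt (he : ε_ A A = μ[A] ≫ ε) (Z : Mod C A) (f : Z.X ⟶ 𝟙_ C) :
    A ◁ linExt Z f ≫ μ[A] ≫ ε = Z.act ≫ f := by
  rw [← he]
  exact eq_curryLeft_iff.1 rfl

/-- Tested by pairing with `A`, linearity reduces to associativity of the action and of the
multiplication. -/
theorem act_linExt (he : ε_ A A = μ[A] ≫ ε) (Z : Mod C A) (f : Z.X ⟶ 𝟙_ C) :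
    Z.act ≫ linExt Z f = A ◁ linExt Z f ≫ μ[A] := by
  have h := whiskerLeft_linExt he Z f
  apply ext_of_whiskerLeft (Y' := A)
  rw [he, whiskerLeft_comp_assoc, whiskerLeft_comp_assoc, h, Mod.act_act_assoc, ← h,
    ← whisker_exchange_assoc, MonObj.mul_assoc_assoc]
  simp

theorem linExt_comp (he : ε_ A A = μ[A] ≫ ε) (Z : Mod C A) (f : Z.X ⟶ 𝟙_ C) :
    linExt Z f ≫ ε = f := by
  have h := congrArg (fun x => η[A] ▷ Z.X ≫ x) (whiskerLeft_linExt he Z f)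
  rw [← whisker_exchange_assoc, MonObj.one_mul_assoc, Mod.one_act_assoc,
    leftUnitor_naturality_assoc] at h
  exact (cancel_epi _).1 h

/-- With `act_linExt` and `linExt_comp`, this makes `g ↦ g ≫ ε` a bijection from linear maps `Z ⟶ A`
to morphisms `Z ⟶ 1`. -/
theorem eq_linExt (he : ε_ A A = μ[A] ≫ ε) (Z : Mod C A) {g : Z.X ⟶ A}
    (hg : Z.act ≫ g = A ◁ g ≫ μ[A]) : g = linExt Z (g ≫ ε) := by
  refine eq_curryLeft_iff.2 ?_
  rw [he, reassoc_of% hg]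

/-- The second triangle identity up to the action of `1 ⟶ A ⊗ A ⟶ A`. -/
theorem coevaluation_curryLeft (V : C) (W : Mod C A) [ExactPairing V W.X] :
    W.X ◁ η_ V W.X ≫ (α_ _ _ _).inv ≫
      curryLeft A A ((α_ A W.X V).inv ≫ W.act ▷ V ≫ ε_ V W.X) ▷ W.X ≫ W.act =
    (ρ_ W.X).hom ≫ (λ_ W.X).inv ≫ (η_ A A ≫ μ[A]) ▷ W.X ≫ W.act := by
  rw [comp_whiskerRight_assoc, Mod.mul_act]
  -- Unfolding exposes a coevaluation `1 ⟶ A ⊗ A`. Once it is slid out of the way, the snake of `V`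
  -- and `W` straightens, and its two legs act on `W` in turn.
  simp only [curryLeft, tensorLeftHomEquiv, Equiv.coe_fn_mk]
  calc _ = 𝟙 _ ⊗≫ (𝟙_ C ◁ (W.X ◁ η_ V W.X) ≫ η_ A A ▷ (W.X ⊗ V ⊗ W.X)) ⊗≫
          A ◁ W.act ▷ V ▷ W.X ⊗≫ A ◁ ε_ V W.X ▷ W.X ⊗≫ W.act := by monoidal
    _ = 𝟙 _ ⊗≫ η_ A A ▷ W.X ⊗≫ A ◁ ((A ⊗ W.X) ◁ η_ V W.X ≫ W.act ▷ (V ⊗ W.X)) ⊗≫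
          A ◁ ε_ V W.X ▷ W.X ⊗≫ W.act := by rw [whisker_exchange]; monoidal
    _ = 𝟙 _ ⊗≫ η_ A A ▷ W.X ⊗≫ A ◁ W.act ⊗≫ A ◁ (W.X ◁ η_ V W.X ⊗≫ ε_ V W.X ▷ W.X) ⊗≫
          W.act := by rw [whisker_exchange]; monoidal
    _ = _ := by rw [ExactPairing.coevaluation_evaluation'']; monoidal

variable [BraidedCategory C] [IsCommMonObj A]

/-- A left linear map is right linear, so the extension can be computed from either side. The two
triangle identities need the two different descriptions. -/
theorem linExt_eq_curryRight (he : ε_ A A = μ[A] ≫ ε) (Z : Mod C A) (f : Z.X ⟶ 𝟙_ C) :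
    linExt Z f = curryRight A A (Z.ract ≫ f) := by
  have h : IsSemilinear (V := Z) (W := Mod.unit A) (𝟙 A) (linExt Z f) :=
    isSemilinear_id_iff.2 (act_linExt he Z f)
  have h' : Z.ract ≫ linExt Z f = linExt Z f ▷ A ≫ μ[A] := by
    have := h.ract
    rwa [Mod.unit_ract, tensorHom_id] at this
  rw [eq_curryRight_iff, he, ← reassoc_of% h', linExt_comp he]

/-- The pairing of `A` with a module does not see the double braiding. -/
theorem monodromy_act (he : ε_ A A = μ[A] ≫ ε) (Z : Mod C A) (f : Z.X ⟶ 𝟙_ C) :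
    (β_ A Z.X).hom ≫ (β_ Z.X A).hom ≫ Z.act ≫ f = Z.act ≫ f := by
  -- The pairing factors through `A ⊗ A` by `linExt`; naturality moves the double braiding there,
  -- and commutativity of `μ` absorbs it.
  rw [← whiskerLeft_linExt he, ← BraidedCategory.braiding_naturality_left_assoc,
    ← BraidedCategory.braiding_naturality_right_assoc, IsCommMonObj.mul_comm_assoc,
    IsCommMonObj.mul_comm_assoc]

/-- The first triangle identity up to the action of `1 ⟶ A ⊗ A ⟶ A`. -/
theorem coevaluation_curryRight (V : Mod C A) (W : C) [ExactPairing V.X W] :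
    η_ V.X W ▷ V.X ≫ (α_ _ _ _).hom ≫
      V.X ◁ curryRight A A ((α_ W V.X A).hom ≫ W ◁ V.ract ≫ ε_ V.X W) ≫ V.ract =
    (λ_ V.X).hom ≫ (ρ_ V.X).inv ≫ V.X ◁ (η_ A A ≫ μ[A]) ≫ V.ract := by
  rw [whiskerLeft_comp_assoc, Mod.mul_ract]
  simp only [curryRight, tensorRightHomEquiv, Equiv.coe_fn_mk]
  calc _ = 𝟙 _ ⊗≫ (η_ V.X W ▷ (V.X ⊗ 𝟙_ C) ≫ (V.X ⊗ W) ◁ (V.X ◁ η_ A A)) ⊗≫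
          V.X ◁ W ◁ V.ract ▷ A ⊗≫ V.X ◁ ε_ V.X W ▷ A ⊗≫ V.ract := by monoidal
    _ = 𝟙 _ ⊗≫ V.X ◁ η_ A A ⊗≫ (η_ V.X W ▷ (V.X ⊗ A) ≫ (V.X ⊗ W) ◁ V.ract) ▷ A ⊗≫
          V.X ◁ ε_ V.X W ▷ A ⊗≫ V.ract := by rw [← whisker_exchange]; monoidal
    _ = 𝟙 _ ⊗≫ V.X ◁ η_ A A ⊗≫ V.ract ▷ A ⊗≫ (η_ V.X W ▷ V.X ⊗≫ V.X ◁ ε_ V.X W) ▷ A ⊗≫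
          V.ract := by rw [← whisker_exchange]; monoidal
    _ = _ := by rw [ExactPairing.evaluation_coevaluation'']; monoidal

end Frobenius

/-! ### Evaluation and coevaluation in `𝒟`. -/

namespace EquivMod

variable {C : Type u} [Category.{v} C] [MonoidalCategory C] {G : Type w} [Group G] {A : C}
  [MonObj A] {π : AlgAction G A} [BraidedCategory C] [IsCommMonObj A] [HasCoequalizers C]
  [RigidCategory C]

section Duality

variable (V W : EquivMod π) [ExactPairing V.X W.X]

/-- The evaluation of `C` as an invariant morphism on `W ⊗_A V`. -/
noncomputable def evMor (hb : IsBalanced W.M V.M (ε_ V.X W.X)) : (W ⊗ V).X ⟶ 𝟙_ C :=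
  relDesc _ hb

@[simp]
theorem pr_evMor (hb : IsBalanced W.M V.M (ε_ V.X W.X)) :
    pr W V ≫ evMor V W hb = ε_ V.X W.X :=
  relProj_relDesc _ _

theorem ρ_evMor (hb : IsBalanced W.M V.M (ε_ V.X W.X))
    (hG : ∀ g, (W.ρ g ⊗ₘ V.ρ g) ≫ ε_ V.X W.X = ε_ V.X W.X) (g : G) :
    (W ⊗ V).ρ g ≫ evMor V W hb = evMor V W hb :=
  pr_ext (by rw [pr_ρ_assoc, pr_evMor, hG])

theorem coev_ρ (hG : ∀ g, (W.ρ g ⊗ₘ V.ρ g) ≫ ε_ V.X W.X = ε_ V.X W.X) (g : G) :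
    (η_ V.X W.X ≫ pr V W) ≫ (V ⊗ W).ρ g = η_ V.X W.X ≫ pr V W := by
  rw [Category.assoc, pr_ρ, ← Category.assoc, coevaluation_tensorHom (f' := V.ρ g⁻¹)
    (g' := W.ρ g⁻¹) _ (hG g⁻¹) _]
  · rw [← ρ_mul, mul_inv_cancel, ρ_one]
  · rw [← ρ_mul, inv_mul_cancel, ρ_one]

end Duality

end EquivMod

namespace EquivMod

variable {C : Type u} [Category.{v} C] [MonoidalCategory C] {G : Type w} [Group G] {A : C}
  [MonObj A] {π : AlgAction G A} [Abelian C] [Linear ℂ C] [MonoidalPreadditive C]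
  [MonoidalLinear ℂ C] [BraidedCategory C] [IsCommMonObj A] [RigidCategory C] [ExactPairing A A]
  {ε : A ⟶ 𝟙_ C}

/-- The morphism `Z ⟶ A` of `𝒟` corresponding to an invariant morphism `Z ⟶ 1` of `C`. -/
noncomputable def toUnit (he : ε_ A A = μ[A] ≫ ε) (hε : ∀ g, (π.π g : A ⟶ A) ≫ ε = ε)
    (Z : EquivMod π) (f : Z.X ⟶ 𝟙_ C) (hf : ∀ g, Z.ρ g ≫ f = f) : Z ⟶ 𝟙_ (EquivMod π) :=
  mkHom (W := oneObj π) (linExt Z.M f) (isSemilinear_id_iff.2 (act_linExt he Z.M f)) (fun g => by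
    have h1 : Z.M.act ≫ linExt Z.M f = A ◁ linExt Z.M f ≫ μ[A] := act_linExt he Z.M f
    have h2 : (oneObj π).ρ g⁻¹ ≫ (oneObj π).ρ g = 𝟙 A := by
      rw [← ρ_mul, mul_inv_cancel]; exact ρ_one (oneObj π)
    -- The conjugate by `g` is again linear, the twists by `π_g` and its inverse cancelling, and has
    -- the same composite with `ε`; uniqueness of linear extensions identifies the two.
    have h3 : Z.ρ g ≫ linExt Z.M f ≫ (oneObj π).ρ g⁻¹ = linExt Z.M f := by
      have h4 : Z.M.act ≫ Z.ρ g ≫ linExt Z.M f ≫ (oneObj π).ρ g⁻¹ =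
          A ◁ (Z.ρ g ≫ linExt Z.M f ≫ (oneObj π).ρ g⁻¹) ≫ μ[A] := by
        have h5 := Z.compat g
        have h6 : μ[A] ≫ (oneObj π).ρ g⁻¹ = ((oneObj π).ρ g⁻¹ ⊗ₘ (oneObj π).ρ g⁻¹) ≫ μ[A] :=
          (oneObj π).compat g⁻¹
        have h7 : (oneObj π).ρ g ≫ (oneObj π).ρ g⁻¹ = 𝟙 A := by
          rw [← ρ_mul, inv_mul_cancel]; exact ρ_one (oneObj π)
        change Z.M.act ≫ Z.ρ g = ((oneObj π).ρ g ⊗ₘ Z.ρ g) ≫ Z.M.act at h5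
        rw [reassoc_of% h5, reassoc_of% h1, h6, tensorHom_comp_whiskerLeft_assoc,
          tensorHom_comp_tensorHom_assoc, h7, id_tensorHom, Category.assoc]
      rw [eq_linExt he Z.M h4]
      congr 1
      simp only [Category.assoc]
      rw [hε, linExt_comp he, hf]
    conv_rhs => rw [← h3, Category.assoc, Category.assoc, h2]
    exact congrArg (Z.ρ g ≫ ·) (Category.comp_id _).symm)

/-- The morphism `A ⟶ Z` of `𝒟` corresponding to an invariant morphism `1 ⟶ Z` of `C`. -/
def fromUnit (Z : EquivMod π) (u : 𝟙_ C ⟶ Z.X) (hu : ∀ g, u ≫ Z.ρ g = u) :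
    𝟙_ (EquivMod π) ⟶ Z :=
  mkHom (V := oneObj π) ((ρ_ A).inv ≫ A ◁ u ≫ Z.M.act)
    (isSemilinear_id_iff.2 (by
      change μ[A] ≫ _ = _
      rw [rightUnitor_inv_naturality_assoc, ← whisker_exchange_assoc, Mod.mul_act]
      simp))
    (fun g => by
      have h := Z.compat g
      change (π.π g : A ⟶ A) ≫ _ = _
      rw [Category.assoc, Category.assoc, h, whiskerLeft_comp_tensorHom_assoc, hu,
        rightUnitor_inv_naturality_assoc, MonoidalCategory.tensorHom_def_assoc])

theorem one_fromUnit (Z : EquivMod π) (u : 𝟙_ C ⟶ Z.X) (hu : ∀ g, u ≫ Z.ρ g = u) :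
    η[A] ≫ toC (fromUnit Z u hu) = u := by
  change η[A] ≫ (ρ_ A).inv ≫ A ◁ u ≫ Z.M.act = u
  rw [rightUnitor_inv_naturality_assoc, ← whisker_exchange_assoc, Mod.one_act]
  simp [unitors_equal]

section Duality

variable (V W : EquivMod π) [ExactPairing V.X W.X]

theorem pr_linExt_evMor (hb : IsBalanced W.M V.M (ε_ V.X W.X)) :
    pr W V ≫ linExt (W ⊗ V).M (evMor V W hb) =
      curryLeft A A ((α_ A W.X V.X).inv ≫ W.M.act ▷ V.X ≫ ε_ V.X W.X) := by
  rw [linExt, comp_curryLeft, pr_act_assoc, pr_evMor]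

theorem pr_linExt_evMor' (he : ε_ A A = μ[A] ≫ ε) (hb : IsBalanced W.M V.M (ε_ V.X W.X)) :
    pr W V ≫ linExt (W ⊗ V).M (evMor V W hb) =
      curryRight A A ((α_ W.X V.X A).hom ≫ W.X ◁ V.M.ract ≫ ε_ V.X W.X) := by
  rw [linExt_eq_curryRight he, comp_curryRight, pr_ract_assoc, pr_evMor]

/-- A duality in `C` whose evaluation is balanced and invariant gives a duality in `𝒟`. -/
noncomputable abbrev exactPairing (he : ε_ A A = μ[A] ≫ ε) (hε : ∀ g, (π.π g : A ⟶ A) ≫ ε = ε)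
    (hb : IsBalanced W.M V.M (ε_ V.X W.X))
    (hG : ∀ g, (W.ρ g ⊗ₘ V.ρ g) ≫ ε_ V.X W.X = ε_ V.X W.X) {c : ℂ} (hc0 : c ≠ 0)
    (hc : η_ A A ≫ μ[A] = c • η[A]) : ExactPairing V W where
  -- The factor `c⁻¹` cancels the scalar by which `η_ A A ≫ μ[A]` acts in both triangle identities.
  coevaluation' := c⁻¹ • fromUnit (V ⊗ W) (η_ V.X W.X ≫ pr V W) (coev_ρ V W hG)
  evaluation' := toUnit he hε (W ⊗ V) (evMor V W hb) (ρ_evMor V W hb hG)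
  coevaluation_evaluation' := by
    rw [Iso.eq_comp_inv]
    apply pr_one_ext_right
    set u := fromUnit (V ⊗ W) (η_ V.X W.X ≫ pr V W) (coev_ρ V W hG)
    have hu : η[A] ≫ toC u = η_ V.X W.X ≫ pr V W := one_fromUnit _ _ _
    set ev := toUnit he hε (W ⊗ V) (evMor V W hb) (ρ_evMor V W hb hG)
    have hev : pr W V ≫ toC ev =
      curryLeft A A ((α_ A W.X V.X).inv ≫ W.M.act ▷ V.X ≫ ε_ V.X W.X) := pr_linExt_evMor V W hb
    simp only [MonoidalLinear.whiskerLeft_smul, Linear.smul_comp, toC_smul, Linear.comp_smul,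
      toC_comp, Category.assoc]
    rw [pr_whiskerLeft_assoc, pr_rightUnitor]
    have h1 : W.X ◁ η[A] ≫ W.X ◁ toC u = W.X ◁ η_ V.X W.X ≫ W.X ◁ pr V W := by
      rw [← whiskerLeft_comp, ← whiskerLeft_comp]; exact congrArg (W.X ◁ ·) hu
    rw [reassoc_of% h1, pr_associator_inv_assoc, pr_whiskerRight_assoc, pr_leftUnitor,
      ← comp_whiskerRight_assoc, hev]
    refine (congrArg (c⁻¹ • ·) (coevaluation_curryLeft V.X W.M)).trans ?_
    rw [hc, MonoidalLinear.smul_whiskerRight, Linear.smul_comp, Mod.one_act]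
    simp only [Linear.comp_smul, smul_smul, inv_mul_cancel₀ hc0, one_smul]
    rw [Iso.inv_hom_id, Category.comp_id]
    exact W.M.one_ract.symm
  evaluation_coevaluation' := by
    rw [Iso.eq_comp_inv]
    apply pr_one_ext_left
    set u := fromUnit (V ⊗ W) (η_ V.X W.X ≫ pr V W) (coev_ρ V W hG)
    have hu : η[A] ≫ toC u = η_ V.X W.X ≫ pr V W := one_fromUnit _ _ _
    set ev := toUnit he hε (W ⊗ V) (evMor V W hb) (ρ_evMor V W hb hG)
    have hev : pr W V ≫ toC ev =
      curryRight A A ((α_ W.X V.X A).hom ≫ W.X ◁ V.M.ract ≫ ε_ V.X W.X) :=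
        pr_linExt_evMor' V W he hb
    simp only [MonoidalLinear.smul_whiskerRight, Linear.smul_comp, toC_smul, Linear.comp_smul,
      toC_comp, Category.assoc]
    rw [pr_whiskerRight_assoc, pr_leftUnitor]
    have h1 : η[A] ▷ V.X ≫ toC u ▷ V.X = η_ V.X W.X ▷ V.X ≫ pr V W ▷ V.X := by
      rw [← comp_whiskerRight, ← comp_whiskerRight]; exact congrArg (· ▷ V.X) hu
    rw [reassoc_of% h1, pr_associator_assoc, pr_whiskerLeft_assoc, pr_rightUnitor,
      ← whiskerLeft_comp_assoc, hev]
    refine (congrArg (c⁻¹ • ·) (coevaluation_curryRight V.M W.X)).trans ?_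
    rw [hc, MonoidalLinear.whiskerLeft_smul, Linear.smul_comp, Mod.one_ract]
    simp only [Linear.comp_smul, smul_smul, inv_mul_cancel₀ hc0, one_smul]
    rw [Iso.inv_hom_id, Category.comp_id]
    exact V.M.one_act.symm

end Duality

end EquivMod

/-! ### The module and group structure on duals. -/

section DualModule

variable {C : Type u} [Category.{v} C] [MonoidalCategory C] {A : C} [MonObj A]
  [BraidedCategory C] [IsCommMonObj A]

/-- A right action of a commutative algebra gives a module. -/
abbrev modOfRight (Y : C) (r : Y ⊗ A ⟶ Y) (h1 : Y ◁ η[A] ≫ r = (ρ_ Y).hom)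
    (h2 : Y ◁ μ[A] ≫ r = (α_ Y A A).inv ≫ r ▷ A ≫ r) : Mod C A where
  X := Y
  mod :=
    { smul := (β_ A Y).hom ≫ r
      one_smul := by
        change η[A] ▷ Y ≫ (β_ A Y).hom ≫ r = (λ_ Y).hom
        rw [BraidedCategory.braiding_naturality_left_assoc, h1]
        simp
      mul_smul := by
        change μ[A] ▷ Y ≫ (β_ A Y).hom ≫ r =
          (α_ A A Y).hom ≫ A ◁ ((β_ A Y).hom ≫ r) ≫ (β_ A Y).hom ≫ r
        have h3 : Y ◁ (β_ A A).hom ≫ (α_ Y A A).inv ≫ r ▷ A ≫ r =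
            (α_ Y A A).inv ≫ r ▷ A ≫ r := by
          rw [← h2, ← whiskerLeft_comp_assoc, IsCommMonObj.mul_comm]
        rw [BraidedCategory.braiding_naturality_left_assoc, h2, whiskerLeft_comp_assoc,
          BraidedCategory.braiding_naturality_right_assoc,
          BraidedCategory.braiding_tensor_left_hom, BraidedCategory.braiding_tensor_right_hom]
        simp only [Category.assoc]
        rw [h3] }

/-- The action on a right dual of a module. -/
def rightDualRact (V : Mod C A) (Y : C) [ExactPairing V.X Y] : Y ⊗ A ⟶ Y :=
  curryRight V.X Y ((α_ Y A V.X).hom ≫ Y ◁ V.act ≫ ε_ V.X Y)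

/-- The action on the dual is the transpose of that on `V`, so this is balancedness of the
evaluation. Pairing with `V` then yields the module axioms from those of `V`. -/
theorem rightDualRact_evaluation (V : Mod C A) (Y : C) [ExactPairing V.X Y] :
    rightDualRact V Y ▷ V.X ≫ ε_ V.X Y = (α_ Y A V.X).hom ≫ Y ◁ V.act ≫ ε_ V.X Y :=
  whiskerRight_curryRight _

/-- The right dual of a module. -/
abbrev rightDualMod (V : Mod C A) (Y : C) [ExactPairing V.X Y] : Mod C A :=
  modOfRight Y (rightDualRact V Y)
    (ext_of_whiskerRight (Y := V.X) (by
      rw [comp_whiskerRight_assoc, rightDualRact_evaluation, associator_naturality_middle_assoc,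
        ← whiskerLeft_comp_assoc, Mod.one_act, triangle_assoc]))
    (ext_of_whiskerRight (Y := V.X) (by
      simp only [comp_whiskerRight_assoc]
      rw [rightDualRact_evaluation, associator_naturality_middle_assoc,
        ← whiskerLeft_comp_assoc, Mod.mul_act, associator_naturality_left_assoc,
        ← whisker_exchange_assoc, rightDualRact_evaluation]
      simp))

theorem rightDualMod_ract (V : Mod C A) (Y : C) [ExactPairing V.X Y] :
    (rightDualMod V Y).ract = rightDualRact V Y :=
  Iso.inv_hom_id_assoc _ _

theorem isBalanced_rightDualMod (V : Mod C A) (Y : C) [ExactPairing V.X Y] :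
    IsBalanced (rightDualMod V Y) V (ε_ V.X Y) := by
  unfold IsBalanced
  rw [rightDualMod_ract]
  exact rightDualRact_evaluation V Y

/-- The action on a left dual of a module. -/
def leftDualAct (V : Mod C A) (Y : C) [ExactPairing Y V.X] : A ⊗ Y ⟶ Y :=
  curryLeft Y V.X ((α_ V.X A Y).inv ≫ V.ract ▷ Y ≫ ε_ Y V.X)

theorem leftDualAct_evaluation (V : Mod C A) (Y : C) [ExactPairing Y V.X] :
    V.X ◁ leftDualAct V Y ≫ ε_ Y V.X = (α_ V.X A Y).inv ≫ V.ract ▷ Y ≫ ε_ Y V.X :=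
  whiskerLeft_curryLeft _

/-- The left dual of a module. -/
abbrev leftDualMod (V : Mod C A) (Y : C) [ExactPairing Y V.X] : Mod C A where
  X := Y
  mod :=
    { smul := leftDualAct V Y
      one_smul := by
        apply ext_of_whiskerLeft (Y' := V.X)
        change V.X ◁ (η[A] ▷ Y ≫ leftDualAct V Y) ≫ _ = V.X ◁ (λ_ Y).hom ≫ _
        rw [whiskerLeft_comp_assoc, leftDualAct_evaluation, associator_inv_naturality_middle_assoc,
          ← comp_whiskerRight_assoc, Mod.one_ract, triangle_assoc_comp_right_assoc]
      mul_smul := by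
        apply ext_of_whiskerLeft (Y' := V.X)
        change V.X ◁ (μ[A] ▷ Y ≫ leftDualAct V Y) ≫ _ =
          V.X ◁ ((α_ A A Y).hom ≫ A ◁ leftDualAct V Y ≫ leftDualAct V Y) ≫ _
        simp only [whiskerLeft_comp_assoc]
        rw [leftDualAct_evaluation, associator_inv_naturality_middle_assoc,
          ← comp_whiskerRight_assoc, Mod.mul_ract, associator_inv_naturality_right_assoc,
          whisker_exchange_assoc, leftDualAct_evaluation]
        simp }

theorem isBalanced_leftDualMod (V : Mod C A) (Y : C) [ExactPairing Y V.X] :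
    IsBalanced V (leftDualMod V Y) (ε_ Y V.X) := by
  unfold IsBalanced
  exact (Iso.inv_comp_eq _).1 (leftDualAct_evaluation V Y).symm

end DualModule

namespace EquivMod

variable {C : Type u} [Category.{v} C] [MonoidalCategory C] {A : C} [MonObj A]
  [BraidedCategory C] [IsCommMonObj A] {G : Type w} [Group G] {π : AlgAction G A}

theorem π_inv_comp (π : AlgAction G A) (g : G) :
    (π.π g : A ⟶ A) ≫ (π.π g⁻¹ : A ⟶ A) = 𝟙 A := by
  rw [← End.mul_def, ← map_mul, inv_mul_cancel, map_one]; rfl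

/-- The right dual of an object of `𝒟`. -/
abbrev rightDualObj (V : EquivMod π) (Y : C) [ExactPairing V.X Y] : EquivMod π where
  M := rightDualMod V.M Y
  φ :=
    { toFun := fun g => curryRight V.X Y (Y ◁ V.ρ g⁻¹ ≫ ε_ V.X Y)
      map_one' := by
        apply ext_of_whiskerRight (Y := V.X)
        rw [whiskerRight_curryRight, inv_one, ρ_one]
        change _ = 𝟙 Y ▷ _ ≫ _
        simp
      map_mul' := fun g h => by
        apply ext_of_whiskerRight (Y := V.X)
        rw [End.mul_def]
        change _ = (curryRight V.X Y _ ≫ curryRight V.X Y _) ▷ _ ≫ _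
        rw [whiskerRight_curryRight, comp_whiskerRight_assoc, whiskerRight_curryRight,
          ← whisker_exchange_assoc, whiskerRight_curryRight, mul_inv_rev, ρ_mul,
          whiskerLeft_comp_assoc] }
  compat g := by
    set ψ : Y ⟶ Y := curryRight V.X Y (Y ◁ V.ρ g⁻¹ ≫ ε_ V.X Y)
    have hψ : ψ ▷ V.X ≫ ε_ V.X Y = Y ◁ V.ρ g⁻¹ ≫ ε_ V.X Y := whiskerRight_curryRight _
    change ((β_ A Y).hom ≫ rightDualRact V.M Y) ≫ ψ =
      ((π.π g : A ⟶ A) ⊗ₘ ψ) ≫ (β_ A Y).hom ≫ rightDualRact V.M Y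
    have h : rightDualRact V.M Y ≫ ψ = (ψ ⊗ₘ (π.π g : A ⟶ A)) ≫ rightDualRact V.M Y := by
      have hc : V.M.act ≫ V.ρ g⁻¹ = ((π.π g⁻¹ : A ⟶ A) ⊗ₘ V.ρ g⁻¹) ≫ V.M.act := V.compat g⁻¹
      apply ext_of_whiskerRight (Y := V.X)
      rw [comp_whiskerRight_assoc, hψ, ← whisker_exchange_assoc, rightDualRact_evaluation,
        comp_whiskerRight_assoc, rightDualRact_evaluation, ← tensorHom_id,
        associator_naturality_assoc, tensorHom_comp_whiskerLeft_assoc, tensorHom_id,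
        MonoidalCategory.tensorHom_def'_assoc, hψ, ← whiskerLeft_comp_assoc, Category.assoc, hc,
        whiskerRight_comp_tensorHom_assoc, π_inv_comp, id_tensorHom]
      simp
    rw [Category.assoc, h, BraidedCategory.braiding_naturality_assoc]

/-- The left dual of an object of `𝒟`. -/
abbrev leftDualObj (V : EquivMod π) (Y : C) [ExactPairing Y V.X] : EquivMod π where
  M := leftDualMod V.M Y
  φ :=
    { toFun := fun g => curryLeft Y V.X (V.ρ g⁻¹ ▷ Y ≫ ε_ Y V.X)
      map_one' := by
        apply ext_of_whiskerLeft (Y' := V.X)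
        rw [whiskerLeft_curryLeft, inv_one, ρ_one]
        change _ = _ ◁ 𝟙 Y ≫ _
        simp
      map_mul' := fun g h => by
        apply ext_of_whiskerLeft (Y' := V.X)
        rw [End.mul_def]
        change _ = _ ◁ (curryLeft Y V.X _ ≫ curryLeft Y V.X _) ≫ _
        rw [whiskerLeft_curryLeft, whiskerLeft_comp_assoc, whiskerLeft_curryLeft,
          whisker_exchange_assoc, whiskerLeft_curryLeft, mul_inv_rev, ρ_mul,
          comp_whiskerRight_assoc] }
  compat g := by
    set ψ : Y ⟶ Y := curryLeft Y V.X (V.ρ g⁻¹ ▷ Y ≫ ε_ Y V.X)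
    have hψ : V.X ◁ ψ ≫ ε_ Y V.X = V.ρ g⁻¹ ▷ Y ≫ ε_ Y V.X := whiskerLeft_curryLeft _
    change leftDualAct V.M Y ≫ ψ = ((π.π g : A ⟶ A) ⊗ₘ ψ) ≫ leftDualAct V.M Y
    have hc : V.M.ract ≫ V.ρ g⁻¹ = (V.ρ g⁻¹ ⊗ₘ (π.π g⁻¹ : A ⟶ A)) ≫ V.M.ract :=
      (V.isSemilinear_ρ g⁻¹).ract
    apply ext_of_whiskerLeft (Y' := V.X)
    rw [whiskerLeft_comp_assoc, hψ, whisker_exchange_assoc, leftDualAct_evaluation,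
      whiskerLeft_comp_assoc, leftDualAct_evaluation, ← id_tensorHom,
      associator_inv_naturality_assoc, tensorHom_comp_whiskerRight_assoc, id_tensorHom,
      MonoidalCategory.tensorHom_def_assoc, hψ, ← comp_whiskerRight_assoc, Category.assoc, hc,
      whiskerLeft_comp_tensorHom_assoc, π_inv_comp, tensorHom_id]
    simp

theorem rightDualObj_ρ_evaluation (V : EquivMod π) (Y : C) [ExactPairing V.X Y] (g : G) :
    ((rightDualObj V Y).ρ g ⊗ₘ V.ρ g) ≫ ε_ V.X Y = ε_ V.X Y := by
  have h : (rightDualObj V Y).ρ g ▷ V.X ≫ ε_ V.X Y = Y ◁ V.ρ g⁻¹ ≫ ε_ V.X Y :=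
    whiskerRight_curryRight _
  rw [MonoidalCategory.tensorHom_def'_assoc, h, ← whiskerLeft_comp_assoc, ← ρ_mul, inv_mul_cancel,
    ρ_one]
  simp

theorem leftDualObj_ρ_evaluation (V : EquivMod π) (Y : C) [ExactPairing Y V.X] (g : G) :
    (V.ρ g ⊗ₘ (leftDualObj V Y).ρ g) ≫ ε_ Y V.X = ε_ Y V.X := by
  have h : V.X ◁ (leftDualObj V Y).ρ g ≫ ε_ Y V.X = V.ρ g⁻¹ ▷ Y ≫ ε_ Y V.X :=
    whiskerLeft_curryLeft _
  rw [MonoidalCategory.tensorHom_def_assoc, h, ← comp_whiskerRight_assoc, ← ρ_mul, inv_mul_cancel,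
    ρ_one]
  simp

end EquivMod

/-! ### Local modules and the descent of the braiding. -/

namespace EquivMod

section Local

variable {C : Type u} [Category.{v} C] [MonoidalCategory C] {A : C} [MonObj A]
  [BraidedCategory C] {G : Type w} [Group G] {π : AlgAction G A}

/-- For a local module the braiding and the inverse braiding define the same right action. -/
theorem _root_.CategoryTheory.Mod.IsLocal.braiding_act {V : Mod C A} (h : V.IsLocal) :
    (β_ V.X A).hom ≫ V.act = V.ract := by
  rw [Mod.ract, Iso.eq_inv_comp]; exact h

variable [IsCommMonObj A]

theorem isLocal_unit : (Mod.unit A).IsLocal := by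
  unfold Mod.IsLocal
  rw [Mod.unit_act, IsCommMonObj.mul_comm, IsCommMonObj.mul_comm]

variable [HasCoequalizers C] [RigidCategory C]

/-- The loop of `A` around `V ⊗ W` is a loop around `W` inside one around `V`. Locality of `V` lets
the action cross to `W`, locality of `W` removes the inner loop, and crossing back leaves the action
on `V`. -/
theorem isLocal_tensor {V W : EquivMod π} (hV : V.M.IsLocal) (hW : W.M.IsLocal) :
    (V ⊗ W).M.IsLocal := by
  unfold Mod.IsLocal
  rw [← cancel_epi (A ◁ pr V W), BraidedCategory.braiding_naturality_right_assoc,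
    BraidedCategory.braiding_naturality_left_assoc, pr_act,
    BraidedCategory.braiding_tensor_right_hom, BraidedCategory.braiding_tensor_left_hom]
  simp only [Category.assoc, Iso.inv_hom_id_assoc, Iso.hom_inv_id_assoc]
  rw [← comp_whiskerRight_assoc, hV.braiding_act, ract_pr, Iso.inv_hom_id_assoc,
    ← whiskerLeft_comp_assoc, ← whiskerLeft_comp_assoc, Category.assoc, hW, ← ract_pr,
    ← comp_whiskerRight_assoc, Mod.braiding_ract]

/-- In a pair of dual modules, the double braidings of `A` with the two factors are inverse to each
other under the evaluation. -/
theorem monodromy_evaluation [ExactPairing A A] {ε : A ⟶ 𝟙_ C} (he : ε_ A A = μ[A] ≫ ε)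
    (V W : EquivMod π) [ExactPairing V.X W.X] (hb : IsBalanced W.M V.M (ε_ V.X W.X)) :
    (α_ W.X A V.X).hom ≫ W.X ◁ ((β_ A V.X).hom ≫ (β_ V.X A).hom) ≫ (α_ W.X A V.X).inv ≫
      ((β_ W.X A).hom ≫ (β_ A W.X).hom) ▷ V.X ≫ W.M.ract ▷ V.X ≫ ε_ V.X W.X =
      W.M.ract ▷ V.X ≫ ε_ V.X W.X := by
  -- The evaluation on `W ⊗_A V` ignores the double braiding with `A`; the hexagons split this into
  -- the loops around the two factors.
  have h := congrArg (fun x => A ◁ pr W V ≫ x) (monodromy_act he (W ⊗ V).M (evMor V W hb))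
  rw [BraidedCategory.braiding_naturality_right_assoc,
    BraidedCategory.braiding_naturality_left_assoc, pr_act_assoc, pr_evMor,
    BraidedCategory.braiding_tensor_right_hom, BraidedCategory.braiding_tensor_left_hom] at h
  simp only [Category.assoc, Iso.inv_hom_id_assoc, Iso.hom_inv_id_assoc] at h
  rw [cancel_epi, ← Mod.braiding_ract, comp_whiskerRight_assoc, cancel_epi] at h
  simpa using h

/-- By balancedness the loop around `V` precedes the action on `V` and is absorbed by locality. By
`monodromy_evaluation` the loop around `W` is then trivial under the evaluation, hence, by
nondegeneracy, under the action. -/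
theorem isLocal_of_exactPairing_right [ExactPairing A A] {ε : A ⟶ 𝟙_ C}
    (he : ε_ A A = μ[A] ≫ ε) {V W : EquivMod π} [ExactPairing V.X W.X]
    (hb : IsBalanced W.M V.M (ε_ V.X W.X)) (hV : V.M.IsLocal) : W.M.IsLocal := by
  have h := monodromy_evaluation he V W hb
  have h1 : (α_ W.X A V.X).hom ≫ W.X ◁ ((β_ A V.X).hom ≫ (β_ V.X A).hom) ≫ (α_ W.X A V.X).inv ≫
      W.M.ract ▷ V.X ≫ ε_ V.X W.X = W.M.ract ▷ V.X ≫ ε_ V.X W.X := by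
    unfold IsBalanced at hb
    rw [hb, Iso.inv_hom_id_assoc, ← whiskerLeft_comp_assoc, Category.assoc, hV]
  have h2 := (cancel_epi ((α_ W.X A V.X).hom ≫ W.X ◁ ((β_ A V.X).hom ≫ (β_ V.X A).hom) ≫
    (α_ W.X A V.X).inv)).1 (by simpa only [Category.assoc] using h.trans h1.symm)
  rw [← comp_whiskerRight_assoc] at h2
  have h3 := ext_of_whiskerRight h2
  rw [Category.assoc, Mod.braiding_ract] at h3
  unfold Mod.IsLocal
  rw [h3, Mod.braiding_ract]

theorem isLocal_of_exactPairing_left [ExactPairing A A] {ε : A ⟶ 𝟙_ C}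
    (he : ε_ A A = μ[A] ≫ ε) {V W : EquivMod π} [ExactPairing V.X W.X]
    (hb : IsBalanced W.M V.M (ε_ V.X W.X)) (hW : W.M.IsLocal) : V.M.IsLocal := by
  have h := monodromy_evaluation he V W hb
  have h1 : ((β_ W.X A).hom ≫ (β_ A W.X).hom) ▷ V.X ≫ W.M.ract ▷ V.X ≫ ε_ V.X W.X =
      W.M.ract ▷ V.X ≫ ε_ V.X W.X := by
    rw [← comp_whiskerRight_assoc, Category.assoc, Mod.braiding_ract, hW.braiding_act]
  unfold IsBalanced at hb
  rw [h1, hb, Iso.inv_hom_id_assoc, cancel_epi, ← whiskerLeft_comp_assoc] at h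
  have h2 := ext_of_whiskerLeft h
  rwa [Category.assoc] at h2

/-- The braiding of `𝒟⁰`, as a morphism of `𝒟`. -/
noncomputable def braidMor {V : EquivMod π} (hV : V.M.IsLocal) (W : EquivMod π) :
    V ⊗ W ⟶ W ⊗ V :=
  tensorDesc (Z := W ⊗ V) ((β_ V.X W.X).hom ≫ pr W V)
    (by
      -- Locality of `V` is used only here, to write its right action as a braiding followed by the
      -- left action; linearity and equivariance below hold without it.
      unfold IsBalanced
      rw [BraidedCategory.braiding_naturality_left_assoc,
        BraidedCategory.braiding_naturality_right_assoc, ← hV.braiding_act,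
        whiskerLeft_comp_assoc, ← BraidedCategory.braiding_naturality_left_assoc,
        (Iso.eq_inv_comp _).2 (ract_pr W V).symm, BraidedCategory.braiding_tensor_left_hom,
        BraidedCategory.braiding_tensor_right_hom, ← Mod.braiding_ract, comp_whiskerRight]
      simp)
    (by
      rw [BraidedCategory.braiding_naturality_left_assoc, whiskerLeft_comp_assoc, pr_act,
        (Iso.eq_inv_comp _).2 (ract_pr W V).symm, BraidedCategory.braiding_tensor_left_hom,
        ← Mod.braiding_ract, comp_whiskerRight]
      simp)
    (fun g => by
      rw [Category.assoc, pr_ρ, BraidedCategory.braiding_naturality_assoc])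

theorem pr_braidMor {V : EquivMod π} (hV : V.M.IsLocal) (W : EquivMod π) :
    pr V W ≫ toC (braidMor hV W) = (β_ V.X W.X).hom ≫ pr W V :=
  proj_tensorDesc _ _ _ _

theorem pr_braidMor_assoc {V : EquivMod π} (hV : V.M.IsLocal) (W : EquivMod π) {Z : C}
    (k : (W ⊗ V).X ⟶ Z) :
    pr V W ≫ toC (braidMor hV W) ≫ k = (β_ V.X W.X).hom ≫ pr W V ≫ k :=
  (reassoc_of% (pr_braidMor hV W)) k

theorem pr_relDesc {V W : EquivMod π} {Z : C} (f : V.X ⊗ W.X ⟶ Z) (hf : IsBalanced V.M W.M f) :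
    pr V W ≫ relDesc f hf = f :=
  relProj_relDesc f hf

theorem isBalanced_braiding_inv {V : EquivMod π} (hV : V.M.IsLocal) (W : EquivMod π) :
    IsBalanced W.M V.M ((β_ V.X W.X).inv ≫ pr V W) := by
  unfold IsBalanced
  have h : V.M.act = (β_ V.X A).inv ≫ V.M.ract := (Iso.eq_inv_comp _).2 hV.braiding_act
  rw [BraidedCategory.braiding_inv_naturality_right_assoc, h, Mod.ract, comp_whiskerRight_assoc,
    BraidedCategory.braiding_inv_naturality_left_assoc, (Iso.eq_inv_comp _).2 (ract_pr V W).symm,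
    BraidedCategory.braiding_tensor_left_inv, BraidedCategory.braiding_tensor_right_inv]
  simp

/-- The braiding of `𝒟⁰`, as an isomorphism of `𝒟`. -/
noncomputable def braidIso {V : EquivMod π} (hV : V.M.IsLocal) (W : EquivMod π) :
    V ⊗ W ≅ W ⊗ V :=
  isoOfInv (braidMor hV W) (relDesc _ (isBalanced_braiding_inv hV W))
    (pr_ext (by rw [pr_braidMor_assoc, pr_relDesc, Iso.hom_inv_id_assoc, Category.comp_id]))
    (pr_ext (by
      rw [reassoc_of% (pr_relDesc _ (isBalanced_braiding_inv hV W)), pr_braidMor,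
        Iso.inv_hom_id_assoc, Category.comp_id]))

end Local

end EquivMod

/-! ### Braiding and balancing of `𝒟⁰`. -/

namespace BraidedTwist

variable {C : Type u} [Category.{v} C] [MonoidalCategory C] [BraidedCategory C]
  (t : BraidedTwist C)

theorem naturality {X Y : C} (f : X ⟶ Y) : t.app X ≫ f = f ≫ t.app Y :=
  (t.θ.hom.naturality f).symm

theorem app_tensor (X Y : C) :
    t.app (X ⊗ Y) = (t.app X ⊗ₘ t.app Y) ≫ (β_ X Y).hom ≫ (β_ Y X).hom :=
  t.tensor X Y

end BraidedTwist

namespace EquivMod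

section LocalBraided

variable {C : Type u} [Category.{v} C] [MonoidalCategory C] {A : C} [MonObj A]
  [BraidedCategory C] {G : Type w} [Group G] {π : AlgAction G A}
  [IsCommMonObj A] [HasCoequalizers C] [RigidCategory C]

instance : (isLocal π).IsMonoidal where
  prop_unit := isLocal_unit
  prop_tensor _ _ := isLocal_tensor

theorem braidMor_naturality_right {U : EquivMod π} (hU : U.M.IsLocal) {V W : EquivMod π}
    (f : V ⟶ W) : U ◁ f ≫ braidMor hU W = braidMor hU V ≫ f ▷ U :=
  tensorObj_ext (by simp [pr_braidMor, pr_braidMor_assoc])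

theorem braidMor_naturality_left {U V : EquivMod π} (hU : U.M.IsLocal) (hV : V.M.IsLocal)
    (f : U ⟶ V) (W : EquivMod π) : f ▷ W ≫ braidMor hV W = braidMor hU W ≫ W ◁ f :=
  tensorObj_ext (by simp [pr_braidMor, pr_braidMor_assoc])

theorem braidMor_hexagon_forward {U : EquivMod π} (hU : U.M.IsLocal) (V W : EquivMod π) :
    (α_ U V W).hom ≫ braidMor hU (V ⊗ W) ≫ (α_ V W U).hom =
      braidMor hU V ▷ W ≫ (α_ V U W).hom ≫ V ◁ braidMor hU W := by
  refine hom_ext' (pr_pr_ext ?_)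
  simp only [toC_comp, pr_associator_assoc, pr_whiskerRight_assoc, pr_braidMor_assoc]
  rw [BraidedCategory.braiding_naturality_right_assoc, pr_associator,
    ← comp_whiskerRight_assoc, pr_braidMor, comp_whiskerRight_assoc, pr_associator_assoc,
    pr_whiskerLeft, ← whiskerLeft_comp_assoc, pr_braidMor, whiskerLeft_comp_assoc]
  simp

theorem braidMor_hexagon_reverse {U V : EquivMod π} (hU : U.M.IsLocal) (hV : V.M.IsLocal)
    (hUV : (U ⊗ V).M.IsLocal) (W : EquivMod π) :
    (α_ U V W).inv ≫ braidMor hUV W ≫ (α_ W U V).inv =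
      U ◁ braidMor hV W ≫ (α_ U W V).inv ≫ braidMor hU W ▷ V := by
  refine tensorObj_ext ((cancel_epi (U.X ◁ pr V W)).1 ?_)
  simp only [toC_comp, pr_associator_inv_assoc, pr_whiskerLeft_assoc, pr_braidMor_assoc]
  rw [BraidedCategory.braiding_naturality_left_assoc, pr_associator_inv,
    ← whiskerLeft_comp_assoc, pr_braidMor, whiskerLeft_comp_assoc, pr_associator_inv_assoc,
    pr_whiskerRight, ← comp_whiskerRight_assoc, pr_braidMor, comp_whiskerRight_assoc]
  simp

noncomputable instance : BraidedCategory (isLocal π).FullSubcategory where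
  braiding V W := (isLocal π).isoMk (braidIso V.property W.obj)
  braiding_naturality_right U _ _ f :=
    ObjectProperty.hom_ext _ (braidMor_naturality_right U.property f.hom)
  braiding_naturality_left {U V} f W :=
    ObjectProperty.hom_ext _ (braidMor_naturality_left U.property V.property f.hom W.obj)
  hexagon_forward U V W :=
    ObjectProperty.hom_ext _ (braidMor_hexagon_forward U.property V.obj W.obj)
  hexagon_reverse U V W :=
    ObjectProperty.hom_ext _ (braidMor_hexagon_reverse U.property V.property (U ⊗ V).property W.obj)

theorem pr_braiding (V W : (isLocal π).FullSubcategory) :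
    pr V.obj W.obj ≫ toC (β_ V W).hom.hom = (β_ V.obj.X W.obj.X).hom ≫ pr W.obj V.obj :=
  pr_braidMor V.property W.obj

theorem pr_braiding_assoc (V W : (isLocal π).FullSubcategory) {Z : C}
    (k : (W.obj ⊗ V.obj).X ⟶ Z) :
    pr V.obj W.obj ≫ toC (β_ V W).hom.hom ≫ k =
      (β_ V.obj.X W.obj.X).hom ≫ pr W.obj V.obj ≫ k :=
  (reassoc_of% (pr_braiding V W)) k

section Twist

variable {t : BraidedTwist C}

/-- By naturality the twist moves to `A ⊗ V`, where with `θ_A = id` it is `id ⊗ θ_V` followed by the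
double braiding; locality removes the latter. -/
theorem act_twist (hθ : t.app A = 𝟙 A) {V : EquivMod π} (hV : V.M.IsLocal) :
    V.M.act ≫ t.app V.X = A ◁ t.app V.X ≫ V.M.act := by
  rw [← t.naturality, t.app_tensor, hθ, id_tensorHom, Category.assoc, Category.assoc, hV]

/-- The balancing of `C` on an object of `𝒟⁰`. -/
def twistIso (hθ : t.app A = 𝟙 A) {V : EquivMod π} (hV : V.M.IsLocal) : V ≅ V :=
  isoOfInv (mkHom (t.app V.X) (isSemilinear_id_iff.2 (act_twist hθ hV))
    (fun g => (t.naturality (V.ρ g)).symm)) (t.θ.inv.app V.X)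
    (t.θ.hom_inv_id_app V.X) (t.θ.inv_hom_id_app V.X)

variable (π) in
/-- The balancing of `𝒟⁰`. -/
def localTwist (hθ : t.app A = 𝟙 A) : BraidedTwist (isLocal π).FullSubcategory where
  θ := NatIso.ofComponents (fun V => (isLocal π).isoMk (twistIso hθ V.property))
    (fun {V W} f => ObjectProperty.hom_ext _ (hom_ext' (t.naturality (toC f.hom)).symm))
  tensor V W := ObjectProperty.hom_ext _ (tensorObj_ext (by
    change pr V.obj W.obj ≫ t.app (V.obj ⊗ W.obj).X = pr V.obj W.obj ≫
      toC ((twistIso hθ V.property).hom ⊗ₘ (twistIso hθ W.property).hom) ≫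
      toC (β_ V W).hom.hom ≫ toC (β_ W V).hom.hom
    -- Naturality of `θ` along the projection reduces the axiom to the balancing axiom on `V.X ⊗
    -- W.X` in `C`.
    rw [pr_tensorHom_assoc, pr_braiding_assoc, pr_braiding, ← t.naturality, t.app_tensor]
    simp only [Category.assoc]
    rfl))

theorem toC_localTwist_app (hθ : t.app A = 𝟙 A) (V : (isLocal π).FullSubcategory) :
    toC ((localTwist π hθ).app V).hom = t.app V.obj.X := rfl

end Twist

end LocalBraided

end EquivMod

/-! ### Rigidity of full monoidal subcategories. -/

namespace CategoryTheory.ObjectProperty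

variable {D : Type u} [Category.{v} D] [MonoidalCategory D] (P : ObjectProperty D) [P.IsMonoidal]

/-- A duality between objects of a monoidal full subcategory. -/
abbrev fullExactPairing (V W : P.FullSubcategory) (e : ExactPairing V.obj W.obj) :
    ExactPairing V W where
  coevaluation' := homMk (η_ V.obj W.obj)
  evaluation' := homMk (ε_ V.obj W.obj)
  coevaluation_evaluation' := hom_ext _ e.coevaluation_evaluation'
  evaluation_coevaluation' := hom_ext _ e.evaluation_coevaluation'

/-- A monoidal full subcategory closed under duals is rigid. -/
abbrev fullRigidCategory [RigidCategory D] (hr : ∀ V, P V → P (Vᘁ)) (hl : ∀ V : D, P V → P (ᘁV)) :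
    RigidCategory P.FullSubcategory where
  rightDual V :=
    { rightDual := ⟨(V.obj)ᘁ, hr _ V.property⟩
      exact := P.fullExactPairing V ⟨(V.obj)ᘁ, hr _ V.property⟩ inferInstance }
  leftDual V :=
    { leftDual := ⟨ᘁ(V.obj), hl _ V.property⟩
      exact := P.fullExactPairing ⟨ᘁ(V.obj), hl _ V.property⟩ V inferInstance }

end CategoryTheory.ObjectProperty

/-! ### Rigidity of `𝒟` and `𝒟⁰`, and the ribbon condition. -/

namespace EquivMod

section Rigid

variable {C : Type u} [Category.{v} C] [MonoidalCategory C] {G : Type w} [Group G] {A : C}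
  [MonObj A] {π : AlgAction G A} [Abelian C] [Linear ℂ C] [MonoidalPreadditive C]
  [MonoidalLinear ℂ C] [BraidedCategory C] [IsCommMonObj A] [RigidCategory C] [ExactPairing A A]
  {ε : A ⟶ 𝟙_ C}

theorem toUnit_ext (he : ε_ A A = μ[A] ≫ ε) {Z : EquivMod π} {f g : Z ⟶ 𝟙_ (EquivMod π)}
    (h : (toC f : Z.X ⟶ A) ≫ ε = (toC g : Z.X ⟶ A) ≫ ε) : f = g := by
  refine hom_ext' ?_
  have hf := eq_linExt he Z.M (g := (toC f : Z.X ⟶ A)) (act_toC f)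
  have hg := eq_linExt he Z.M (g := (toC g : Z.X ⟶ A)) (act_toC g)
  rw [h, ← hg] at hf
  exact hf

theorem isLocal_rightDual (he : ε_ A A = μ[A] ≫ ε) (V : EquivMod π) (hV : V.M.IsLocal) :
    (rightDualObj V (V.X)ᘁ).M.IsLocal :=
  isLocal_of_exactPairing_right he (isBalanced_rightDualMod V.M (V.X)ᘁ) hV

theorem isLocal_leftDual (he : ε_ A A = μ[A] ≫ ε) (V : EquivMod π) (hV : V.M.IsLocal) :
    (leftDualObj V (ᘁ(V.X))).M.IsLocal :=
  isLocal_of_exactPairing_left he (isBalanced_leftDualMod V.M (ᘁ(V.X))) hV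

section

variable (he : ε_ A A = μ[A] ≫ ε) (hε : ∀ g, (π.π g : A ⟶ A) ≫ ε = ε) {c : ℂ} (hc0 : c ≠ 0)
  (hc : η_ A A ≫ μ[A] = c • η[A])

/-- `𝒟` is rigid, the duals being those of `C`. -/
noncomputable abbrev rigidCategory : RigidCategory (EquivMod π) where
  rightDual V :=
    { rightDual := rightDualObj V (V.X)ᘁ
      exact := exactPairing V _ he hε (isBalanced_rightDualMod V.M _)
        (rightDualObj_ρ_evaluation V _) hc0 hc }
  leftDual V :=
    { leftDual := leftDualObj V (ᘁ(V.X))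
      exact := exactPairing _ V he hε (isBalanced_leftDualMod V.M _)
        (leftDualObj_ρ_evaluation V _) hc0 hc }

theorem pr_evaluation (V : EquivMod π) :
    letI := rigidCategory he hε hc0 hc
    pr (Vᘁ) V ≫ (toC (ε_ V (Vᘁ)) : _ ⟶ A) ≫ ε = ε_ V.X (V.X)ᘁ := by
  have h1 := linExt_comp he (rightDualObj V (V.X)ᘁ ⊗ V).M
    (evMor V (rightDualObj V (V.X)ᘁ) (isBalanced_rightDualMod V.M _))
  refine (congrArg (pr (rightDualObj V (V.X)ᘁ) V ≫ ·) h1).trans ?_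
  exact pr_evMor _ _ _

theorem isNaturalDual (V : EquivMod π) :
    letI := rigidCategory he hε hc0 hc
    IsNaturalDual pr unitIso ε V (Vᘁ) (ε_ V (Vᘁ)) (Iso.refl ((V.X)ᘁ)) := by
  let := rigidCategory he hε hc0 hc
  refine { action := fun g => ?_, evaluation := ?_ }
  · have : (V.ρ g⁻¹)ᘁ = (rightDualObj V (V.X)ᘁ).ρ g :=
      eq_curryRight_iff.2 (rightAdjointMate_comp_evaluation _)
    rw [this]
    exact (Category.comp_id _).trans (Category.id_comp _).symm
  · have h : (Iso.refl ((V.X)ᘁ)).hom ▷ V.X ≫ ε_ V.X (V.X)ᘁ = ε_ V.X (V.X)ᘁ := by simp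
    refine Eq.trans ?_ ((pr_evaluation he hε hc0 hc V).trans h.symm)
    exact congrArg (fun x => pr (Vᘁ) V ≫ (toC (ε_ V (Vᘁ)) : _ ⟶ A) ≫ x) (Category.id_comp ε)

/-- `𝒟⁰` is rigid, with the duals of `𝒟`. -/
noncomputable abbrev rigidCategoryLocal : RigidCategory (isLocal π).FullSubcategory :=
  letI := rigidCategory he hε hc0 hc
  (isLocal π).fullRigidCategory (isLocal_rightDual he) (isLocal_leftDual he)

/-- Both sides are tested against the evaluation of `𝒟⁰`, and morphisms into its unit against `ε`.
Under the projection this evaluation becomes that of `C`, leaving the ribbon identity of `C`. -/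
theorem isRibbon_localTwist {t : BraidedTwist C} (hθ : t.app A = 𝟙 A) (ht : t.IsRibbon) :
    letI := rigidCategoryLocal he hε hc0 hc
    (localTwist π hθ).IsRibbon := by
  let := rigidCategory he hε hc0 hc
  let := rigidCategoryLocal he hε hc0 hc
  intro V
  apply ext_of_whiskerRight (Y := V)
  rw [rightAdjointMate_comp_evaluation]
  refine ObjectProperty.hom_ext _ (toUnit_ext he (pr_ext ?_))
  let T := (twistIso hθ V.property).hom
  let S := (twistIso hθ (isLocal_rightDual he V.obj V.property)).hom
  change pr (V.objᘁ) V.obj ≫ (toC (S ▷ V.obj) ≫ (toC (ε_ V.obj (V.objᘁ)) : _ ⟶ A)) ≫ ε =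
    pr (V.objᘁ) V.obj ≫ (toC (V.objᘁ ◁ T) ≫ (toC (ε_ V.obj (V.objᘁ)) : _ ⟶ A)) ≫ ε
  rw [Category.assoc, Category.assoc, pr_whiskerRight_assoc, pr_whiskerLeft_assoc]
  have h := pr_evaluation he hε hc0 hc V.obj
  refine (congrArg (toC S ▷ V.obj.X ≫ ·) h).trans
    (Eq.trans ?_ (congrArg ((V.objᘁ).X ◁ toC T ≫ ·) h).symm)
  change t.app ((V.obj.X)ᘁ) ▷ V.obj.X ≫ ε_ V.obj.X (V.obj.X)ᘁ =
    (V.obj.X)ᘁ ◁ t.app V.obj.X ≫ ε_ V.obj.X (V.obj.X)ᘁ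
  rw [ht, rightAdjointMate_comp_evaluation]

end

end Rigid

/-! ### Scalars coming from `dim Hom(1, A) = 1` and `dim A ≠ 0`. -/

section Scalars

variable {C : Type u} [Category.{v} C] [MonoidalCategory C] {A : C}
  [MonObj A] [Preadditive C] [Linear ℂ C] [MonoidalPreadditive C] [MonoidalLinear ℂ C]
  {ε : A ⟶ 𝟙_ C}

theorem exists_smul_one (h : Module.finrank ℂ (𝟙_ C ⟶ A) = 1) (h1 : η[A] ≫ ε = 𝟙 (𝟙_ C))
    (u : 𝟙_ C ⟶ A) : ∃ c : ℂ, u = c • η[A] := by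
  -- If the unit of `A` vanished, the counit identity would give `𝟙 (𝟙_ C) = 0`, so every morphism
  -- out of `1` would be zero.
  by_cases h0 : η[A] = 0
  · have h2 : 𝟙 (𝟙_ C) = 0 := by rw [← h1, h0, zero_comp]
    exact ⟨0, by rw [← Category.id_comp u, h2, zero_comp, zero_smul]⟩
  · obtain ⟨c, hc⟩ := exists_smul_eq_of_finrank_eq_one h h0 u
    exact ⟨c, hc.symm⟩

variable [ExactPairing A A]

/-- The form makes `A` self-dual, so `Hom(A, 1)` corresponds to `Hom(1, A)`, with `ε` matching the
unit. -/
theorem exists_smul_counit (h : Module.finrank ℂ (𝟙_ C ⟶ A) = 1) (h1 : η[A] ≫ ε = 𝟙 (𝟙_ C))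
    (he : ε_ A A = μ[A] ≫ ε) (f : A ⟶ 𝟙_ C) : ∃ c : ℂ, f = c • ε := by
  obtain ⟨c, hc⟩ := exists_smul_one h h1 (curryRight A A ((λ_ A).hom ≫ f))
  refine ⟨c, ?_⟩
  have h2 := eq_curryRight_iff.1 hc.symm
  rw [he, MonoidalLinear.smul_whiskerRight, Linear.smul_comp, MonObj.one_mul_assoc,
    ← Linear.comp_smul, cancel_epi] at h2
  exact h2.symm

theorem counit_invariant (h : Module.finrank ℂ (𝟙_ C ⟶ A) = 1) (h1 : η[A] ≫ ε = 𝟙 (𝟙_ C))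
    (he : ε_ A A = μ[A] ≫ ε) {G : Type w} [Group G] (π : AlgAction G A) (g : G) :
    (π.π g : A ⟶ A) ≫ ε = ε := by
  obtain ⟨c, hc⟩ := exists_smul_counit h h1 he ((π.π g : A ⟶ A) ≫ ε)
  have h2 : η[A] ≫ (π.π g : A ⟶ A) ≫ ε = 𝟙 _ := by
    rw [← Category.assoc, (π.isMonHom g).one_hom, h1]
  rw [hc, Linear.comp_smul, h1] at h2
  rw [hc]
  calc c • ε = ε ≫ (c • 𝟙 (𝟙_ C)) := by rw [Linear.comp_smul, Category.comp_id]
    _ = ε := by rw [h2, Category.comp_id]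

/-- The dimension may be computed with `A` as its own dual. As `θ_A = id` and `μ` absorbs the
braiding, it is `η_ A A ≫ μ[A] ≫ ε`, which would vanish if `c` did. -/
theorem exists_coevaluation_mul [BraidedCategory C] [IsCommMonObj A] [RightRigidCategory C]
    (h : Module.finrank ℂ (𝟙_ C ⟶ A) = 1) (h1 : η[A] ≫ ε = 𝟙 (𝟙_ C)) (he : ε_ A A = μ[A] ≫ ε)
    {t : BraidedTwist C} (hθ : t.app A = 𝟙 A) (hd : t.dim A ≠ 0) :
    ∃ c : ℂ, c ≠ 0 ∧ η_ A A ≫ μ[A] = c • η[A] := by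
  obtain ⟨c, hc⟩ := exists_smul_one h h1 (η_ A A ≫ μ[A])
  refine ⟨c, ?_, hc⟩
  rintro rfl
  apply hd
  rw [BraidedTwist.dim, hθ, id_whiskerRight, Category.id_comp,
    coevaluation_braiding_evaluation_eq inferInstance (inferInstance : ExactPairing A A), he,
    IsCommMonObj.mul_comm_assoc, reassoc_of% hc, zero_smul, zero_comp]

end Scalars

end EquivMod

theorem mainTheorem12
    {C : Type u} [Category.{v} C] [Abelian C] [Linear ℂ C] [MonoidalCategory C]
    [MonoidalPreadditive C] [MonoidalLinear ℂ C] [RigidCategory C] [BraidedCategory C]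
    (hfin : ∀ X Y : C, FiniteDimensional ℂ (X ⟶ Y))
    (hss : IsSemisimpleCategory C) (hunit : Simple (𝟙_ C))
    (t : BraidedTwist C)
    (A : C) [MonObj A] (ε : A ⟶ 𝟙_ C) (hA : IsRigidCommAlgebra t A ε) (hθ : t.app A = 𝟙 A)
    {G : Type w} [Group G] [Finite G] (π : AlgAction G A)
    (hfaithful : Function.Injective π.π) (hinv : π.InvariantsEqUnit) :
    ∃ (_ : MonoidalCategory (EquivMod π))
      (p : ∀ V W : EquivMod π, V.X ⊗ W.X ⟶ (V ⊗ W).X)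
      (e : 𝟙_ (EquivMod π) ≅ EquivMod.algObj π)
      (_ : RigidCategory (EquivMod π)),
      -- `𝒟` is a rigid tensor category with the stated tensor product and duals
      EquivMod.IsNaturalTensor p e ∧
      IsTensorCategory (EquivMod π) ∧
      (∀ V : EquivMod π, ∃ d : (Vᘁ).X ≅ (V.X)ᘁ,
        EquivMod.IsNaturalDual p e ε V (Vᘁ) (ε_ V (Vᘁ)) d) ∧
      -- `𝒟⁰` is closed under `⊗`, the unit and duals, ...
      (∀ V : EquivMod π, V.M.IsLocal → (Vᘁ).M.IsLocal ∧ (ᘁV).M.IsLocal) ∧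
      ∃ _ : (EquivMod.isLocal π).IsMonoidal,
        IsTensorCategory (EquivMod.isLocal π).FullSubcategory ∧
        -- ... and is a balanced rigid braided category, with braiding and twist those of `C`
        ∃ (_ : RigidCategory (EquivMod.isLocal π).FullSubcategory)
          (_ : BraidedCategory (EquivMod.isLocal π).FullSubcategory)
          (t₀ : BraidedTwist (EquivMod.isLocal π).FullSubcategory),
          (∀ V W : (EquivMod.isLocal π).FullSubcategory,
            p V.obj W.obj ≫ EquivMod.toC (β_ V W).hom.hom =
              (β_ V.obj.X W.obj.X).hom ≫ p W.obj V.obj) ∧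
          (∀ V : (EquivMod.isLocal π).FullSubcategory,
            EquivMod.toC (t₀.app V).hom = t.app V.obj.X) ∧
          (t.IsRibbon → t₀.IsRibbon) := by
  obtain ⟨hcomm, hhap, hcounit, ⟨e, he⟩, hdim⟩ := hA
  -- From here on `A` is its own dual through `ε ∘ μ`, and `η_ A A` is the coevaluation of this
  -- pairing.
  let : ExactPairing A A := e
  have hε := EquivMod.counit_invariant hhap hcounit he π
  obtain ⟨c, hc0, hc⟩ := EquivMod.exists_coevaluation_mul hhap hcounit he hθ hdim
  let := EquivMod.rigidCategory he hε hc0 hc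
  exact ⟨inferInstance, EquivMod.pr, EquivMod.unitIso, EquivMod.rigidCategory he hε hc0 hc,
    EquivMod.isNaturalTensor_pr, EquivMod.isTensorCategory π hfin hhap,
    fun V => ⟨Iso.refl _, EquivMod.isNaturalDual he hε hc0 hc V⟩,
    fun V hV => ⟨EquivMod.isLocal_rightDual he V hV, EquivMod.isLocal_leftDual he V hV⟩,
    inferInstance, EquivMod.isTensorCategory_isLocal π hfin hhap,
    EquivMod.rigidCategoryLocal he hε hc0 hc, inferInstance, EquivMod.localTwist π hθ,
    EquivMod.pr_braiding, EquivMod.toC_localTwist_app hθ,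
    EquivMod.isRibbon_localTwist he hε hc0 hc hθ⟩
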